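/- Let $\mathbb{F}_q$ be a finite field of characteristic $>3$, let $K=\mathbb{F}_q(t)$, and let $K_\infty=\mathbb{F}_q((t^{-1}))$ be its completion at infinity. Let $F_1,F_2\in K[x_1,\dots,x_n]$ be a cubic form and a quadratic form, and let $M\in K^{n\times n}$ be the symmetric matrix with $F_2(x)=x^tMx$. Suppose that the cubic hypersurface $V(F_1)\subset\mathbb{P}^{n-1}$ is non-singular and that $X=V(F_1,F_2)\subset\mathbb{P}^{n-1}$ is a non-singular complete intersection (that is, $\nabla F_1(x)\neq 0$ for every $x\in\overline{K}^n\setminus\{0\}$ with $F_1(x)=0$, and $\nabla F_1(x),\nabla F_2(x)$ are linearly independent for every $x\in\overline K^n\setminus\{0\}$ with $F_1(x)=F_2(x)=0$). Let $H(x)=\left(\frac{\partial^2F_1}{\partial x_i\partial x_j}(x)\right)_{i,j}$ denote the Hessian of $F_1$. (i) Let $\Omega$ be any algebraically closed extension field of $K$ and let $1\le k\le n-1$. Let $V_k$ be the Zariski closure in $\mathbb{A}^n(\Omega)=\Omega^n$ of $$\{x\in\Omega^n : \operatorname{rk}(t_1H(x)+t_2M)\le k\ \text{for some } (t_1,t_2)\in\Omega^2\setminus\{0\}\}.$$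 Then $\dim V_k\le k+1$. (ii) Suppose that $n\ge 14$ or, more generally, that $X(K_\infty)\neq\emptyset$. Then there exists $x_0\in K_\infty^n$ with $F_1(x_0)=F_2(x_0)=0$, $\operatorname{rk}H(x_0)\ge n-2$, and $\operatorname{rk}(t_1H(x_0)+t_2M)\ge n-3$ for all $(t_1,t_2)\in K_\infty^2\setminus\{(0,0)\}$. -/

import Mathlib

noncomputable section

namespace CubicQuadric

open MvPolynomial

section

variable {n : ℕ} {K : Type*} [Field K] {L : Type*} [Field L] [Algebra K L]

/-- The gradient of a polynomial over `K` at a point with coordinates in an extension `L` of `K`. -/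
def gradientAt (P : MvPolynomial (Fin n) K) (x : Fin n → L) : Fin n → L :=
  fun i => aeval x (pderiv i P)

/-- The Hessian matrix `H(x)` of second partial derivatives of `P` at a point `x ∈ Lⁿ`. -/
def hessianAt (P : MvPolynomial (Fin n) K) (x : Fin n → L) : Matrix (Fin n) (Fin n) L :=
  Matrix.of fun i j => aeval x (pderiv i (pderiv j P))

/-- The quadratic form `xᵗ M x`. -/
def quadraticFormOf (M : Matrix (Fin n) (Fin n) K) : MvPolynomial (Fin n) K :=
  ∑ i, ∑ j, C (M i j) * X i * X j

/-- The member `t₁ H(x) + t₂ M` of the pencil, a matrix over the extension `L` of `K`. -/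
def pencilAt (P : MvPolynomial (Fin n) K) (M : Matrix (Fin n) (Fin n) K) (t₁ t₂ : L)
    (x : Fin n → L) : Matrix (Fin n) (Fin n) L :=
  t₁ • hessianAt P x + t₂ • M.map (algebraMap K L)

/-- The projective hypersurface `V(P)` of a form `P` is non-singular: the gradient does not vanish
at any of its geometric points. -/
def IsNonsingularForm (P : MvPolynomial (Fin n) K) : Prop :=
  ∀ x : Fin n → AlgebraicClosure K, x ≠ 0 → aeval x P = 0 → gradientAt P x ≠ 0

/-- The projective scheme `V(P, Q)` of two forms is a non-singular complete intersection, by the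
Jacobian criterion: the gradients are linearly independent at each of its geometric points.
(This forces `V(P, Q)` to have codimension two at each of its points.) -/
def IsNonsingularCompleteIntersection (P Q : MvPolynomial (Fin n) K) : Prop :=
  ∀ x : Fin n → AlgebraicClosure K, x ≠ 0 → aeval x P = 0 → aeval x Q = 0 →
    LinearIndependent (AlgebraicClosure K) ![gradientAt P x, gradientAt Q x]

/-- The set of `x ∈ Lⁿ` such that `t₁ H(x) + t₂ M` has rank at most `k` for some
`(t₁, t₂) ∈ L² ∖ {0}`. -/
def lowRankLocus (L : Type*) [Field L] [Algebra K L] (P : MvPolynomial (Fin n) K)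
    (M : Matrix (Fin n) (Fin n) K) (k : ℕ) : Set (Fin n → L) :=
  {x | ∃ t₁ t₂ : L, (t₁, t₂) ≠ (0, 0) ∧ (pencilAt P M t₁ t₂ x).rank ≤ k}

/-- The Zariski closure of a subset of affine `n`-space over `L`. -/
def zariskiClosure (S : Set (Fin n → L)) : Set (Fin n → L) :=
  zeroLocus L (vanishingIdeal L S)

/-- The dimension of a Zariski closed subset `V` of affine `n`-space over an algebraically closed
field `L`: the Krull dimension of its coordinate ring `L[x₁, …, xₙ] / I(V)`. -/
def affineDim (V : Set (Fin n → L)) : WithBot ℕ∞ :=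
  ringKrullDim (MvPolynomial (Fin n) L ⧸ vanishingIdeal L V)

end

end CubicQuadric

end

/-! Both parts rest on one integrality statement. Let `(H(x) + tM) y = 0`. Then every coordinate of
`x` is integral over any ring of scalars containing `K`, `t` and the coordinates of `x - y`.
Otherwise some valuation ring contains that ring while `x` has a pole. Dividing the equation twice
by the coordinate of `x` with the largest pole and reducing kills both `tM` and `x - y`, leaving a
nonzero residue vector `x'` with `H(x') x' = 0`. By Euler, `H(x') x' = 2∇F₁(x')`, and this is
nonzero because `V(F₁)` is non-singular and the characteristic exceeds 3.

Now let `E = k(x, t)`, let `H(x) + tM` have corank `ρ` over `E`, and let `y` be the generic kernel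
vector, with `ρ` new indeterminates as coefficients. The field generated by `E` and the
indeterminates is algebraic over the algebra generated by `x - y` and `t`. Hence `trdeg E + ρ ≤ n +
1`, that is, `trdeg E ≤ rank + 1`, and even `trdeg E ≤ rank` when `t = 0`
(`trdeg_le_rank_add_card`).

For (i) this is applied at the generic point of each component of the locus. Matrices with `t₁ = 0`
play no role for `k < n - 1`, since `M` has corank at most one (`le_rank_add_one`); for `k = n - 1`
the bound is trivial.

For (ii), a point of `X` over `K_∞` exists by hypothesis or, for `n ≥ 14`, by a Tsen–Lang argument.
The implicit function theorem lets all but two coordinates vary in open sets, and since `K` is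
countable they can be made algebraically independent over `K` (`exists_generic_point`). Then `trdeg
≥ n - 2`, which forces the ranks up. -/

noncomputable section

namespace CubicQuadric

open MvPolynomial

/-! ### Transfer of solvability to the algebraic closure -/

section Transfer

variable {K L : Type*} [Field K] [Field L] [Algebra K L]

/-- A system of polynomial equations that is solvable in some extension field is solvable in the
algebraic closure. -/
theorem exists_algebraicClosure_point {σ : Type*} [Finite σ] (S : Set (MvPolynomial σ K))
    (x : σ → L) (hx : ∀ p ∈ S, aeval x p = 0) :
    ∃ z : σ → AlgebraicClosure K, ∀ p ∈ S, aeval z p = 0 := by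
  have hne : Ideal.span S ≠ ⊤ := by
    intro h
    have hle : Ideal.span S ≤ vanishingIdeal K {x} :=
      Ideal.span_le.2 fun p hp => (mem_vanishingIdeal_singleton_iff x p).2 (hx p hp)
    have h1 : (1 : MvPolynomial σ K) ∈ vanishingIdeal K {x} := hle (h ▸ Submodule.mem_top)
    simp at h1
  obtain ⟨m, hm, hle⟩ := Ideal.exists_le_maximal _ hne
  obtain ⟨z, rfl⟩ := eq_vanishingIdeal_singleton_of_isMaximal (AlgebraicClosure K) hm
  exact ⟨z, fun p hp => (mem_vanishingIdeal_singleton_iff z p).1 (hle (Ideal.subset_span hp))⟩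

theorem aeval_smul_of_isHomogeneous {σ : Type*} {p : MvPolynomial σ K} {d : ℕ}
    (hp : p.IsHomogeneous d) (c : L) (x : σ → L) :
    aeval (c • x) p = c ^ d * aeval x p := by
  simp only [aeval_def, eval₂_eq, Finset.mul_sum]
  refine Finset.sum_congr rfl fun m hm => ?_
  have hd : m.degree = d := by
    have := hp (mem_support_iff.1 hm)
    rw [Finsupp.degree_eq_weight_one]
    exact this
  simp only [Pi.smul_apply, smul_eq_mul, mul_pow, Finset.prod_mul_distrib,
    Finset.prod_pow_eq_pow_sum]
  rw [← hd, Finsupp.degree_apply]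
  ring

/-- A system of homogeneous equations with a nonzero solution in some extension field has a nonzero
solution in the algebraic closure. -/
theorem exists_algebraicClosure_point_ne_zero {σ : Type*} [Finite σ] (S : Set (MvPolynomial σ K))
    (hS : ∀ p ∈ S, ∃ d, p.IsHomogeneous d) (x : σ → L) (hx0 : x ≠ 0)
    (hx : ∀ p ∈ S, aeval x p = 0) :
    ∃ z : σ → AlgebraicClosure K, z ≠ 0 ∧ ∀ p ∈ S, aeval z p = 0 := by
  obtain ⟨i, hi⟩ := Function.ne_iff.1 hx0
  have hi : x i ≠ 0 := hi
  -- Homogeneity allows scaling to `x i = 1`; the equation `X i - 1` then keeps the new solution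
  -- nonzero.
  obtain ⟨z, hz⟩ := exists_algebraicClosure_point (insert (X i - 1) S) ((x i)⁻¹ • x) (by
    rintro p (rfl | hp)
    · simp [hi]
    · obtain ⟨d, hd⟩ := hS p hp
      rw [aeval_smul_of_isHomogeneous hd, hx p hp, mul_zero])
  refine ⟨z, ?_, fun p hp => hz p (Set.mem_insert_of_mem _ hp)⟩
  rintro rfl
  simpa using hz _ (Set.mem_insert _ _)

end Transfer

/-! ### Euler's identity and the Hessian of a cubic form -/

section Derivatives

variable {K L : Type*} [Field K] [Field L] [Algebra K L] {n : ℕ}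

/-- The commutator of two derivations is a derivation, and this one kills the variables. -/
theorem pderiv_pderiv_comm {R σ : Type*} [CommRing R] (i j : σ) (p : MvPolynomial σ R) :
    pderiv i (pderiv j p) = pderiv j (pderiv i p) := by
  classical
  have h : ⁅(pderiv i : Derivation R (MvPolynomial σ R) (MvPolynomial σ R)),
      pderiv (R := R) j⁆ = 0 := by
    refine derivation_ext (R := R) fun k => ?_
    rw [Derivation.commutator_apply]
    simp only [pderiv_X, Pi.single_apply, Derivation.zero_apply]
    split_ifs <;> simp
  have := congrArg (fun D : Derivation R (MvPolynomial σ R) (MvPolynomial σ R) => D p) h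
  simpa [Derivation.commutator_apply, sub_eq_zero] using this

theorem sum_mul_gradientAt {P : MvPolynomial (Fin n) K} {d : ℕ} (hP : P.IsHomogeneous d)
    (x : Fin n → L) : ∑ i, x i * gradientAt P x i = d * aeval x P := by
  have := congrArg (aeval x) hP.sum_X_mul_pderiv
  simpa [gradientAt] using this

/-- Euler's identity for the partial derivatives, which are quadratic forms. -/
theorem hessianAt_mulVec_self {P : MvPolynomial (Fin n) K} (hP : P.IsHomogeneous 3)
    (x : Fin n → L) : (hessianAt P x).mulVec x = (2 : L) • gradientAt P x := by
  ext i
  have h := sum_mul_gradientAt (hP.pderiv (i := i)) x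
  simp only [gradientAt] at h
  simp only [Matrix.mulVec, dotProduct, hessianAt, Matrix.of_apply, Pi.smul_apply, smul_eq_mul,
    gradientAt]
  rw [show (2 : L) = ((3 - 1 : ℕ) : L) by norm_num, ← h]
  exact Finset.sum_congr rfl fun j _ => by rw [pderiv_pderiv_comm, mul_comm]

/-- For a nonsingular cubic form the gradient vanishes only at the origin, over any extension. -/
theorem gradientAt_ne_zero {P : MvPolynomial (Fin n) K} (hP : P.IsHomogeneous 3)
    (hns : IsNonsingularForm P) (h3 : (3 : K) ≠ 0) (x : Fin n → L) (hx : x ≠ 0) :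
    gradientAt P x ≠ 0 := by
  intro h
  obtain ⟨z, hz0, hz⟩ := exists_algebraicClosure_point_ne_zero (Set.range fun i => pderiv i P)
    (by rintro _ ⟨i, rfl⟩; exact ⟨_, hP.pderiv⟩) x hx
    (by rintro _ ⟨i, rfl⟩; exact congrFun h i)
  have hg : gradientAt P z = 0 := funext fun i => hz _ ⟨i, rfl⟩
  refine hns z hz0 ?_ hg
  have h3' : ((3 : ℕ) : AlgebraicClosure K) ≠ 0 := by
    have := (map_ne_zero (algebraMap K (AlgebraicClosure K))).2 h3
    simpa only [map_ofNat, Nat.cast_ofNat] using this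
  have := sum_mul_gradientAt hP z
  simp only [hg, Pi.zero_apply, mul_zero, Finset.sum_const_zero] at this
  exact (mul_eq_zero.1 this.symm).resolve_left h3'

theorem hessianAt_mulVec_self_ne_zero {P : MvPolynomial (Fin n) K} (hP : P.IsHomogeneous 3)
    (hns : IsNonsingularForm P) (h2 : (2 : K) ≠ 0) (h3 : (3 : K) ≠ 0) (x : Fin n → L)
    (hx : x ≠ 0) : (hessianAt P x).mulVec x ≠ 0 := by
  rw [hessianAt_mulVec_self hP]
  refine smul_ne_zero ?_ (gradientAt_ne_zero hP hns h3 x hx)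
  have := (map_ne_zero (algebraMap K L)).2 h2
  simpa only [map_ofNat] using this

end Derivatives

/-! ### Integrality of `x` through valuation rings -/

section Integrality

variable {K E : Type*} [Field K] [Field E] [Algebra K E] {n : ℕ}

/-- The integral closure of a subring of a field is the intersection of the valuation rings
containing it. -/
theorem isIntegral_of_forall_mem_valuationSubring (R : Subring E) (z : E)
    (h : ∀ V : ValuationSubring E, R ≤ V.toSubring → z ∈ V) : IsIntegral R z := by
  have := (iInf_valuationSubring_superset (s := (R : Set E))).le
    (x := z) (by simpa [Subring.mem_iInf] using h)
  rwa [Subring.closure_eq] at this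

/-- If `y` is in the kernel of `H(x) + t M`, then the coordinates of `x` are integral over any ring
of scalars that contains `t` and the coordinates of `x - y`. -/
theorem isIntegral_of_pencil_mulVec_eq_zero {P : MvPolynomial (Fin n) K} (hP : P.IsHomogeneous 3)
    (hns : IsNonsingularForm P) (h2 : (2 : K) ≠ 0) (h3 : (3 : K) ≠ 0)
    (M : Matrix (Fin n) (Fin n) K) (R : Subring E) (hR : ∀ c : K, algebraMap K E c ∈ R)
    (x y : Fin n → E) (t : E) (ht : t ∈ R) (hxy : ∀ i, x i - y i ∈ R)
    (h : (hessianAt P x + t • M.map (algebraMap K E)).mulVec y = 0) (i : Fin n) :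
    IsIntegral R (x i) := by
  refine isIntegral_of_forall_mem_valuationSubring R (x i) fun V hV => ?_
  by_contra hi
  obtain ⟨l, -, hl⟩ := Finset.exists_max_image Finset.univ (fun j => V.valuation (x j))
    ⟨i, Finset.mem_univ i⟩
  have hl1 : 1 < V.valuation (x l) := by
    have h1 : 1 < V.valuation (x i) := by
      rwa [← V.valuation_le_one_iff, not_le] at hi
    exact h1.trans_le (hl i (Finset.mem_univ i))
  have hl0 : x l ≠ 0 := by
    intro h0
    simp [h0] at hl1
  have hinv : V.valuation (x l)⁻¹ < 1 := by
    rw [map_inv₀]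
    exact inv_lt_one_of_one_lt₀ hl1
  -- `w` is the inverse of the coordinate with the largest pole, so it lies in the maximal ideal,
  -- and `x' = w x` is integral with `l`-th coordinate 1.
  let w : V := ⟨(x l)⁻¹, (V.valuation_le_one_iff _).1 hinv.le⟩
  have hwm : w ∈ IsLocalRing.maximalIdeal V := (V.valuation_lt_one_iff w).2 hinv
  let x' : Fin n → V := fun j => ⟨(x l)⁻¹ * x j, (V.valuation_le_one_iff _).1 (by
    rw [map_mul, map_inv₀]
    exact inv_mul_le_one_of_le₀ (hl j (Finset.mem_univ j)) zero_le)⟩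
  let d : Fin n → V := fun j => ⟨x j - y j, hV (hxy j)⟩
  let t' : V := ⟨t, hV ht⟩
  let f : K →+* V := (algebraMap K E).codRestrict V.toSubring fun c => hV (hR c)
  let : Algebra K V := f.toAlgebra
  have hE : ∀ p : MvPolynomial (Fin n) K,
      aeval (fun j => (x' j : E)) p = ((aeval x' p : V) : E) := by
    intro p
    have : algebraMap K E = V.subtype.comp f := rfl
    simp only [aeval_def]
    rw [this]
    exact (eval₂_comp_left V.subtype f x' p).symm
  let : Algebra K (IsLocalRing.ResidueField V) := ((IsLocalRing.residue V).comp f).toAlgebra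
  have hres : ∀ p : MvPolynomial (Fin n) K,
      aeval (fun j => IsLocalRing.residue V (x' j)) p = IsLocalRing.residue V (aeval x' p) := by
    intro p
    simp only [aeval_def]
    exact (eval₂_comp_left (IsLocalRing.residue V) f x' p).symm
  have hxl : IsLocalRing.residue V (x' l) ≠ 0 := by
    have : x' l = 1 := Subtype.ext (inv_mul_cancel₀ hl0)
    simp [this]
  refine hessianAt_mulVec_self_ne_zero hP hns h2 h3 (fun j => IsLocalRing.residue V (x' j))
    (fun h0 => hxl (congrFun h0 l)) ?_
  have hx' : (fun j => (x' j : E)) = (x l)⁻¹ • x := rfl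
  ext a
  -- The kernel equation times `w²`: `H` is linear in `x` and absorbs one factor, while the other
  -- turns `y` into `x' - w d`. All terms now lie in `V`.
  have ha : ∑ b, ((aeval x' (pderiv a (pderiv b P)) : V) + (w * t') * f (M a b)) *
      (x' b - w * d b) = 0 := by
    refine Subtype.ext ?_
    have h0 := congrFun h a
    have h1 : ∀ b, (((aeval x' (pderiv a (pderiv b P)) : V) : E)) =
        (x l)⁻¹ * aeval x (pderiv a (pderiv b P)) := by
      intro b
      rw [← hE, hx', aeval_smul_of_isHomogeneous (hP.pderiv.pderiv)]
      norm_num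
    have hf : ∀ c, ((f c : V) : E) = algebraMap K E c := fun _ => rfl
    simp only [Matrix.mulVec, dotProduct, Matrix.add_apply, hessianAt, Matrix.of_apply,
      Matrix.smul_apply, Matrix.map_apply, smul_eq_mul, Pi.zero_apply] at h0
    have : (∑ b, ((aeval x (pderiv a (pderiv b P)) : E) + t * algebraMap K E (M a b)) * y b)
        * ((x l)⁻¹ * (x l)⁻¹) = 0 := by rw [h0, zero_mul]
    push_cast
    simp only [h1, hf]
    rw [← this, Finset.sum_mul]
    refine Finset.sum_congr rfl fun b _ => ?_
    simp only [w, t', x', d]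
    ring
  -- Modulo the maximal ideal only `H(x') x' = 0` survives.
  have hw : IsLocalRing.residue V w = 0 := Ideal.Quotient.eq_zero_iff_mem.2 hwm
  have hb := congrArg (IsLocalRing.residue V) ha
  simp only [map_sum, map_mul, map_add, map_sub, hw, zero_mul, add_zero, sub_zero, map_zero] at hb
  simpa only [Matrix.mulVec, dotProduct, hessianAt, Matrix.of_apply, hres, Pi.zero_apply] using hb

end Integrality

/-! ### Rank, minors and kernels of matrices -/

section Rank

variable {E E' : Type*} [Field E] [Field E'] {m n : Type*} [Fintype m] [Fintype n]

theorem exists_linearIndependent_submatrix_row (A : Matrix m n E) {d : ℕ} (hd : A.rank = d) :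
    ∃ r : Fin d → m, LinearIndependent E (A.submatrix r id).row := by
  subst hd
  obtain ⟨f, hf, hli⟩ : ∃ f : Fin A.rank → n → E, (∀ i, f i ∈ Set.range A.row) ∧
      LinearIndependent E f := by
    rw [A.rank_eq_finrank_span_row]
    obtain ⟨f, hf, -, hli⟩ := Submodule.exists_fun_fin_finrank_span_eq E (Set.range A.row)
    exact ⟨f, hf, hli⟩
  choose r hr using hf
  exact ⟨r, by convert hli using 1; exact funext hr⟩

theorem exists_det_submatrix_ne_zero (A : Matrix m n E) :
    ∃ (r : Fin A.rank → m) (c : Fin A.rank → n), (A.submatrix r c).det ≠ 0 := by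
  obtain ⟨r, hr⟩ := exists_linearIndependent_submatrix_row A rfl
  obtain ⟨c, hc⟩ := exists_linearIndependent_submatrix_row (A.submatrix r id).transpose
    (d := A.rank) (by rw [Matrix.rank_transpose, hr.rank_matrix, Fintype.card_fin])
  refine ⟨r, c, ?_⟩
  rw [← isUnit_iff_ne_zero, ← Matrix.isUnit_iff_isUnit_det, ← Matrix.isUnit_transpose,
    ← Matrix.linearIndependent_rows_iff_isUnit]
  exact hc
theorem le_rank_of_det_submatrix_ne_zero {m : Type*} (A : Matrix m n E) {d : ℕ} (r : Fin d → m)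
    (c : Fin d → n) (h : (A.submatrix r c).det ≠ 0) : d ≤ A.rank := by
  have h1 := Matrix.rank_of_isUnit (A.submatrix r c)
    ((Matrix.isUnit_iff_isUnit_det _).2 (isUnit_iff_ne_zero.2 h))
  rw [Fintype.card_fin] at h1
  exact h1.symm.le.trans (Matrix.rank_submatrix_le A r c)

/-- Rank is detected by nonvanishing minors, and a homomorphism of fields preserves these. -/
theorem rank_map_ringHom (f : E →+* E') (A : Matrix m n E) : (A.map f).rank = A.rank := by
  have hdet : ∀ (d : ℕ) (r : Fin d → m) (c : Fin d → n),
      ((A.map f).submatrix r c).det = f (A.submatrix r c).det := fun d r c => by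
    rw [RingHom.map_det, RingHom.mapMatrix_apply, Matrix.submatrix_map]
  apply le_antisymm
  · obtain ⟨r, c, h⟩ := exists_det_submatrix_ne_zero (A.map f)
    exact le_rank_of_det_submatrix_ne_zero A r c fun h0 => h (by rw [hdet, h0, map_zero])
  · obtain ⟨r, c, h⟩ := exists_det_submatrix_ne_zero A
    exact le_rank_of_det_submatrix_ne_zero (A.map f) r c
      (by rw [hdet]; exact (map_ne_zero f).2 h)

/-- A basis of the kernel of a matrix, as the columns of a matrix with a left inverse. -/
theorem exists_kernel_matrix {n : ℕ} (A : Matrix (Fin n) (Fin n) E) :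
    ∃ (ρ : ℕ) (B : Matrix (Fin n) (Fin ρ) E) (C : Matrix (Fin ρ) (Fin n) E),
      A.rank + ρ = n ∧ A * B = 0 ∧ C * B = 1 := by
  let ρ := Module.finrank E (LinearMap.ker A.mulVecLin)
  let b : Module.Basis (Fin ρ) E (LinearMap.ker A.mulVecLin) := Module.finBasis _ _
  let g : (Fin ρ → E) →ₗ[E] (Fin n → E) :=
    (LinearMap.ker A.mulVecLin).subtype.comp b.equivFun.symm.toLinearMap
  have hg : LinearMap.ker g = ⊥ := LinearMap.ker_eq_bot.2
    ((Submodule.injective_subtype _).comp b.equivFun.symm.injective)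
  obtain ⟨h, hh⟩ := g.exists_leftInverse_of_injective hg
  refine ⟨ρ, LinearMap.toMatrix' g, LinearMap.toMatrix' h, ?_, ?_, ?_⟩
  · have := LinearMap.finrank_range_add_finrank_ker A.mulVecLin
    rwa [Module.finrank_fin_fun] at this
  · have : A.mulVecLin.comp g = 0 := LinearMap.ext fun c => (b.equivFun.symm c).2
    have h1 := congrArg LinearMap.toMatrix' this
    rw [LinearMap.toMatrix'_comp] at h1
    rwa [← Matrix.toLin'_apply', LinearMap.toMatrix'_toLin', map_zero] at h1
  · rw [← LinearMap.toMatrix'_comp, hh, LinearMap.toMatrix'_id]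

end Rank

/-! ### Bounding the transcendence degree by the rank -/

section TranscendenceDegree

universe u
variable {K k : Type*} [Field K] [Field k] [Algebra K k]

/-- The elements that are algebraic over a subalgebra form an intermediate field. -/
def algebraicOver {E : Type*} [Field E] [Algebra k E] (A : Subalgebra k E) :
    IntermediateField k E where
  __ := (Subalgebra.algebraicClosure A E).restrictScalars k
  inv_mem' x hx := by
    have hx : IsAlgebraic A x := hx
    exact hx.inv

theorem mem_algebraicOver {E : Type*} [Field E] [Algebra k E] {A : Subalgebra k E} {x : E} :
    x ∈ algebraicOver A ↔ IsAlgebraic A x := Iff.rfl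

/-- `E'` plays the role of `E(u)` and `y = Bu` is the generic kernel vector. The `n + s.card`
elements `x i - y i` and `s` generate an algebra over which `x`, hence `E`, then `y` and `u`, are
algebraic. The coefficient field `K` is kept apart from the base `k`, which is the algebraically
closed field in (i) and `K` itself in (ii). -/
theorem trdeg_add_le_of_mulVec_eq_zero {E E' : Type u} [Field E] [Field E'] [Algebra k E]
    [Algebra k E'] [Algebra E E'] [IsScalarTower k E E'] [Algebra K E] [IsScalarTower K k E]
    {n : ℕ} {P : MvPolynomial (Fin n) K} (hP : P.IsHomogeneous 3)
    (hns : IsNonsingularForm P) (h2 : (2 : K) ≠ 0) (h3 : (3 : K) ≠ 0)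
    (M : Matrix (Fin n) (Fin n) K) (x : Fin n → E) (t : E)
    (hgen : IntermediateField.adjoin k (insert t (Set.range x)) = ⊤)
    (s : Finset E) (hs : t ∈ Algebra.adjoin k (s : Set E))
    {ρ : ℕ} (u : Fin ρ → E') (hu : AlgebraicIndependent E u)
    (hugen : IntermediateField.adjoin E (Set.range u) = ⊤)
    (B : Matrix (Fin n) (Fin ρ) E) (C : Matrix (Fin ρ) (Fin n) E)
    (hB : (hessianAt P x + t • M.map (algebraMap K E)) * B = 0) (hC : C * B = 1) :
    Algebra.trdeg k E + ρ ≤ n + s.card := by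
  classical
  let ι := algebraMap E E'
  let y : Fin n → E' := (B.map ι).mulVec u
  let S : Set E' := Set.range (fun i => ι (x i) - y i) ∪ ι '' s
  let A := Algebra.adjoin k S
  let T := algebraicOver A
  have hAT : ∀ z ∈ A, z ∈ T := fun z hz =>
    mem_algebraicOver.2 (isAlgebraic_algebraMap (⟨z, hz⟩ : A))
  let _ : Algebra K E' := (ι.comp (algebraMap K E)).toAlgebra
  have hKE' : ∀ c, algebraMap K E' c = algebraMap k E' (algebraMap K k c) := by
    intro c
    change ι (algebraMap K E c) = _
    rw [IsScalarTower.algebraMap_apply K k E, IsScalarTower.algebraMap_apply k E E']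
  have htA : ι t ∈ A := by
    have h1 : ι t ∈ (Algebra.adjoin k (s : Set E)).map (IsScalarTower.toAlgHom k E E') :=
      ⟨t, hs, rfl⟩
    rw [AlgHom.map_adjoin] at h1
    exact Algebra.adjoin_mono Set.subset_union_right h1
  have hess : hessianAt P (fun i => ι (x i)) = (hessianAt P x).map ι := by
    ext i j
    simp only [hessianAt, Matrix.of_apply, Matrix.map_apply, aeval_def]
    exact (eval₂_comp_left ι (algebraMap K E) x _).symm
  have hker : (hessianAt P (fun i => ι (x i)) +
      ι t • M.map (algebraMap K E')).mulVec y = 0 := by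
    have h1 : hessianAt P (fun i => ι (x i)) + ι t • M.map (algebraMap K E') =
        (hessianAt P x + t • M.map (algebraMap K E)).map ι := by
      rw [hess]
      ext i j
      simp only [Matrix.add_apply, Matrix.smul_apply, Matrix.map_apply, smul_eq_mul, map_add,
        map_mul]
      rfl
    rw [h1, Matrix.mulVec_mulVec, ← Matrix.map_mul, hB]
    simp
  have hxT : ∀ i, ι (x i) ∈ T := by
    intro i
    have h1 := isIntegral_of_pencil_mulVec_eq_zero hP hns h2 h3 M A.toSubring
      (fun c => by rw [hKE']; exact A.algebraMap_mem _) (fun i => ι (x i)) y (ι t) htA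
      (fun i => Algebra.subset_adjoin (Or.inl ⟨i, rfl⟩)) hker i
    exact mem_algebraicOver.2 (IsIntegral.isAlgebraic (R := A) h1)
  have hET : ∀ e, ι e ∈ T := by
    intro e
    have h1 : IntermediateField.adjoin k (insert t (Set.range x)) ≤
        T.comap (IsScalarTower.toAlgHom k E E') := by
      rw [IntermediateField.adjoin_le_iff]
      rintro _ (rfl | ⟨i, rfl⟩)
      · exact hAT _ htA
      · exact hxT i
    rw [hgen] at h1
    exact h1 (IntermediateField.mem_top (x := e))
  have hyT : ∀ i, y i ∈ T := fun i => by
    have h1 := T.sub_mem (hxT i) (hAT _ (Algebra.subset_adjoin (Or.inl ⟨i, rfl⟩)))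
    simpa using h1
  have huT : ∀ j, u j ∈ T := by
    -- The left inverse `C` of `B` recovers the indeterminates from `y`.
    have h1 : (C.map ι).mulVec y = u := by
      rw [Matrix.mulVec_mulVec, ← Matrix.map_mul, hC]
      simp
    intro j
    rw [← h1]
    change ∑ i, ι (C j i) * y i ∈ T
    exact T.sum_mem fun i _ => T.mul_mem (hET _) (hyT i)
  have hT : ∀ z, z ∈ T := by
    intro z
    let T' : IntermediateField E E' := { T with algebraMap_mem' := hET }
    have h1 : IntermediateField.adjoin E (Set.range u) ≤ T' := by
      rw [IntermediateField.adjoin_le_iff]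
      rintro _ ⟨j, rfl⟩
      exact huT j
    rw [hugen] at h1
    exact h1 (IntermediateField.mem_top (x := z))
  have halg : Algebra.IsAlgebraic A E' := ⟨fun z => hT z⟩
  have h1 : Algebra.trdeg k E' ≤ Cardinal.mk S := Algebra.IsAlgebraic.trdeg_le_cardinalMk k S
  have h2 : Cardinal.mk S ≤ ((n + s.card : ℕ) : Cardinal) := by
    have : S = ((Finset.univ.image (fun i => ι (x i) - y i) ∪ s.image ι : Finset E') : Set E') := by
      simp [S]
    rw [this]
    refine Cardinal.mk_coe_finset.le.trans ?_
    refine Nat.cast_le.2 ((Finset.card_union_le _ _).trans (add_le_add ?_ Finset.card_image_le))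
    exact Finset.card_image_le.trans (by simp)
  have h3 : (ρ : Cardinal) ≤ Algebra.trdeg E E' := by
    have := hu.lift_cardinalMk_le_trdeg
    simpa using this
  calc Algebra.trdeg k E + ρ ≤ Algebra.trdeg k E + Algebra.trdeg E E' := by gcongr
    _ = Algebra.trdeg k E' := trdeg_add_eq k E
    _ ≤ _ := by exact_mod_cast h1.trans h2

/-- The transcendence degree of `k(x, t)` is bounded by the rank of `H(x) + t M`, up to the number
of elements needed to generate `t`. -/
theorem trdeg_le_rank_add_card {E : Type u} [Field E] [Algebra k E] [Algebra K E]
    [IsScalarTower K k E] {n : ℕ} {P : MvPolynomial (Fin n) K} (hP : P.IsHomogeneous 3)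
    (hns : IsNonsingularForm P) (h2 : (2 : K) ≠ 0) (h3 : (3 : K) ≠ 0)
    (M : Matrix (Fin n) (Fin n) K) (x : Fin n → E) (t : E)
    (hgen : IntermediateField.adjoin k (insert t (Set.range x)) = ⊤)
    (s : Finset E) (hs : t ∈ Algebra.adjoin k (s : Set E)) :
    Algebra.trdeg k E ≤ ((hessianAt P x + t • M.map (algebraMap K E)).rank + s.card : ℕ) := by
  obtain ⟨ρ, B, C, hρ, hB, hC⟩ :=
    exists_kernel_matrix (hessianAt P x + t • M.map (algebraMap K E))
  let E' := FractionRing (MvPolynomial (Fin ρ) E)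
  let u : Fin ρ → E' := fun j => algebraMap (MvPolynomial (Fin ρ) E) E' (X j)
  have hu : AlgebraicIndependent E u :=
    (MvPolynomial.algebraicIndependent_X (Fin ρ) E).map'
      (f := IsScalarTower.toAlgHom E (MvPolynomial (Fin ρ) E) E')
      (IsFractionRing.injective (MvPolynomial (Fin ρ) E) E')
  have hpoly : ∀ p : MvPolynomial (Fin ρ) E,
      algebraMap _ E' p ∈ IntermediateField.adjoin E (Set.range u) := by
    intro p
    induction p using MvPolynomial.induction_on with
    | C a => exact IntermediateField.algebraMap_mem _ a
    | add p q hp hq => rw [map_add]; exact add_mem hp hq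
    | mul_X p j hp =>
      rw [map_mul]
      exact mul_mem hp (IntermediateField.subset_adjoin _ _ ⟨j, rfl⟩)
  have hugen : IntermediateField.adjoin E (Set.range u) = ⊤ := by
    refine top_unique fun z _ => ?_
    obtain ⟨p, q, -, rfl⟩ := IsFractionRing.div_surjective (A := MvPolynomial (Fin ρ) E) z
    exact div_mem (hpoly p) (hpoly q)
  have key := trdeg_add_le_of_mulVec_eq_zero (E' := E') hP hns h2 h3 M x t hgen s hs u hu hugen
    B C hB hC
  have h4 : Algebra.trdeg k E + ρ ≤
      ((hessianAt P x + t • M.map (algebraMap K E)).rank + s.card : ℕ) + ρ := by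
    refine key.trans (le_of_eq ?_)
    rw [← Nat.cast_add, ← Nat.cast_add]
    congr 1
    omega
  exact (Cardinal.add_le_add_iff_of_lt_aleph0 (Cardinal.natCast_lt_aleph0)).1 h4

end TranscendenceDegree

/-! ### Krull dimension of finitely generated algebras -/

section KrullDimension

/-- Incomparability: contraction along an integral extension is strictly monotone on primes. -/
theorem ringKrullDim_le_of_isIntegral {A B : Type*} [CommRing A] [CommRing B] [Algebra A B]
    [Algebra.IsIntegral A B] : ringKrullDim B ≤ ringKrullDim A := by
  refine Order.krullDim_le_of_strictMono (PrimeSpectrum.comap (algebraMap A B)) fun p q hpq => ?_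
  obtain ⟨hle, z, hzq, hzp⟩ := SetLike.lt_iff_le_and_exists.1
    (show p.asIdeal < q.asIdeal from hpq)
  exact Ideal.comap_lt_comap_of_integral_mem_sdiff hle ⟨hzq, hzp⟩
    (Algebra.IsIntegral.isIntegral z)

/-- The Krull dimension of a finitely generated domain is at most the number of elements of some
algebraically independent family. -/
theorem exists_algebraicIndependent_ringKrullDim_le (k A : Type*) [Field k] [CommRing A]
    [Nontrivial A] [Algebra k A] [Algebra.FiniteType k A] :
    ∃ (s : ℕ) (v : Fin s → A), AlgebraicIndependent k v ∧ ringKrullDim A ≤ s := by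
  obtain ⟨s, g, hg, hint⟩ := exists_integral_inj_algHom_of_fg k A
  refine ⟨s, fun j => g (X j), (algebraicIndependent_X (Fin s) k).map' hg, ?_⟩
  let _ : Algebra (MvPolynomial (Fin s) k) A := g.toRingHom.toAlgebra
  have : Algebra.IsIntegral (MvPolynomial (Fin s) k) A := ⟨hint⟩
  refine (ringKrullDim_le_of_isIntegral (A := MvPolynomial (Fin s) k)).trans (le_of_eq ?_)
  rw [MvPolynomial.ringKrullDim_of_isNoetherianRing, ringKrullDim_eq_zero_of_field, zero_add,
    Nat.card_fin]

/-- The bottom of a chain of primes over `I` contains a minimal prime of `I`, so the whole chain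
lives over that prime. -/
theorem ringKrullDim_quotient_le_of_minimalPrimes {R : Type*} [CommRing R] (I : Ideal R)
    (d : WithBot ℕ∞) (h : ∀ p ∈ I.minimalPrimes, ringKrullDim (R ⧸ p) ≤ d) :
    ringKrullDim (R ⧸ I) ≤ d := by
  rw [ringKrullDim_quotient, Order.krullDim]
  refine iSup_le fun l => ?_
  obtain ⟨p, hp, hpl⟩ := Ideal.exists_minimalPrimes_le
    (show I ≤ l.head.1.asIdeal from l.head.2)
  refine le_trans ?_ (h p hp)
  rw [ringKrullDim_quotient]
  let l' : LTSeries (PrimeSpectrum.zeroLocus (R := R) p) :=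
    { length := l.length
      toFun := fun i => ⟨(l i).1, hpl.trans (l.monotone (Fin.zero_le i))⟩
      step := fun i => l.step i }
  exact Order.LTSeries.length_le_krullDim l'

end KrullDimension

/-! ### The quadratic form and the corank of `M` -/

section Quadric

variable {K L : Type*} [Field K] [Field L] [Algebra K L] {n : ℕ}

theorem aeval_quadraticFormOf (M : Matrix (Fin n) (Fin n) K) (x : Fin n → L) :
    aeval x (quadraticFormOf M) = ∑ i, x i * (M.map (algebraMap K L)).mulVec x i := by
  simp only [quadraticFormOf, map_sum, map_mul, aeval_C, aeval_X, Matrix.mulVec, dotProduct,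
    Matrix.map_apply, Finset.mul_sum]
  exact Finset.sum_congr rfl fun i _ => Finset.sum_congr rfl fun j _ => by ring

theorem gradientAt_quadraticFormOf {M : Matrix (Fin n) (Fin n) K} (hM : M.IsSymm)
    (x : Fin n → L) :
    gradientAt (quadraticFormOf M) x = (2 : L) • (M.map (algebraMap K L)).mulVec x := by
  classical
  ext l
  simp only [gradientAt, quadraticFormOf, map_sum, pderiv_mul, pderiv_C, pderiv_X, zero_mul,
    zero_add, map_add, map_mul, aeval_C, aeval_X, Finset.sum_add_distrib, Pi.single_apply,
    Pi.smul_apply, smul_eq_mul, Matrix.mulVec, dotProduct, Matrix.map_apply]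
  have h2 : ∀ i : Fin n, (aeval x) (if i = l then (1 : MvPolynomial (Fin n) K) else 0) =
      if i = l then (1 : L) else 0 := by intro i; split_ifs <;> simp
  simp only [h2, mul_ite, ite_mul, mul_one, mul_zero, zero_mul, Finset.sum_ite_eq',
    Finset.mem_univ, if_true, Finset.sum_ite_irrel, Finset.sum_const_zero]
  rw [two_mul]
  congr 1
  exact Finset.sum_congr rfl fun i _ => by rw [hM.apply, mul_comm]

theorem aeval_add_smul_eq_eval (P : MvPolynomial (Fin n) K) (v w : Fin n → L) (c : L) :
    aeval (v + c • w) P = (aeval (fun i => Polynomial.C (v i) + Polynomial.C (w i) * Polynomial.X)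
      P : Polynomial L).eval c := by
  rw [← Polynomial.coe_evalRingHom, aeval_def, aeval_def, eval₂_comp_left]
  congr 1
  · ext a
    rw [RingHom.comp_apply, IsScalarTower.algebraMap_apply K L (Polynomial L),
      Polynomial.algebraMap_eq, Polynomial.coe_evalRingHom, Polynomial.eval_C]
  · ext i
    rw [Function.comp_apply, Polynomial.coe_evalRingHom, Polynomial.eval_add, Polynomial.eval_C,
      Polynomial.eval_mul, Polynomial.eval_C, Polynomial.eval_X, Pi.add_apply, Pi.smul_apply,
      smul_eq_mul, mul_comm]

/-- A form of positive degree over an algebraically closed field has a nontrivial zero on every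
line of projective space. -/
theorem exists_zero_on_line [IsAlgClosed L] {P : MvPolynomial (Fin n) K} {d : ℕ} (hd : d ≠ 0)
    (hP : P.IsHomogeneous d) (v w : Fin n → L) :
    ∃ a b : L, (a, b) ≠ (0, 0) ∧ aeval (a • v + b • w) P = 0 := by
  by_cases hw : aeval w P = 0
  · exact ⟨0, 1, by simp, by simpa using hw⟩
  let p : Polynomial L :=
    aeval (fun i => Polynomial.C (v i) + Polynomial.C (w i) * Polynomial.X) P
  by_cases hp : p.degree = 0
  · exfalso
    apply hw
    let q : Polynomial L :=
      aeval (fun i => Polynomial.C (w i) + Polynomial.C (v i) * Polynomial.X) P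
    obtain ⟨c, hc⟩ : ∃ c, p = Polynomial.C c := ⟨_, Polynomial.eq_C_of_degree_eq_zero hp⟩
    -- `q` is `p` with the roles of `v` and `w` exchanged, so `q(z) = z ^ d p(1/z)`. For constant
    -- `p` this vanishes at 0, where its value is `P(w)`.
    have hq : q = Polynomial.C c * Polynomial.X ^ d := by
      refine Polynomial.eq_of_infinite_eval_eq _ _ ?_
      refine (Set.infinite_univ.sdiff (Set.finite_singleton (0 : L))).mono fun z hz => ?_
      have hz0 : z ≠ 0 := fun h => hz.2 h
      have h1 : w + z • v = z • (v + z⁻¹ • w) := by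
        rw [smul_add, smul_inv_smul₀ hz0, add_comm]
      have h2 : aeval (w + z • v) P = z ^ d * c := by
        rw [h1, aeval_smul_of_isHomogeneous hP, aeval_add_smul_eq_eval]
        change z ^ d * p.eval z⁻¹ = _
        rw [hc, Polynomial.eval_C]
      rw [aeval_add_smul_eq_eval] at h2
      change q.eval z = _
      rw [Polynomial.eval_mul, Polynomial.eval_C, Polynomial.eval_pow, Polynomial.eval_X, mul_comm]
      exact h2
    have h3 := aeval_add_smul_eq_eval P w v 0
    rw [zero_smul, add_zero] at h3
    rw [h3]
    change q.eval 0 = 0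
    simp [hq, hd]
  · obtain ⟨c, hc⟩ := IsAlgClosed.exists_root p hp
    refine ⟨1, c, by simp, ?_⟩
    rw [one_smul, aeval_add_smul_eq_eval]
    exact hc

/-- The quadratic form of a nonsingular complete intersection has corank at most one. -/
theorem le_rank_add_one {P : MvPolynomial (Fin n) K} (hP : P.IsHomogeneous 3)
    {M : Matrix (Fin n) (Fin n) K} (hM : M.IsSymm)
    (hX : IsNonsingularCompleteIntersection P (quadraticFormOf M)) : n ≤ M.rank + 1 := by
  by_contra hlt
  let f := algebraMap K (AlgebraicClosure K)
  obtain ⟨ρ, B, C, hρ, hB, hC⟩ := exists_kernel_matrix (M.map f)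
  rw [rank_map_ringHom] at hρ
  -- Corank at least two gives a projective line in the kernel of `M`. It meets the cubic, and at
  -- such a point the quadratic form and its gradient both vanish.
  obtain ⟨i, j, hij⟩ : ∃ i j : Fin ρ, i ≠ j :=
    ⟨⟨0, by omega⟩, ⟨1, by omega⟩, by simp⟩
  obtain ⟨a, b, hab, h0⟩ := exists_zero_on_line (by norm_num) hP (B.mulVec (Pi.single i 1))
    (B.mulVec (Pi.single j 1))
  let z : Fin ρ → AlgebraicClosure K := a • Pi.single i 1 + b • Pi.single j 1
  have hz : z ≠ 0 := by
    intro hz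
    apply hab
    have h1 := congrFun hz i
    have h2 := congrFun hz j
    simp [z, hij, hij.symm] at h1 h2
    rw [h1, h2]
  have hBz : B.mulVec z = a • B.mulVec (Pi.single i 1) + b • B.mulVec (Pi.single j 1) := by
    simp only [z, Matrix.mulVec_add, Matrix.mulVec_smul]
  rw [← hBz] at h0
  have hBz0 : B.mulVec z ≠ 0 := by
    intro h
    apply hz
    have := congrArg C.mulVec h
    rwa [Matrix.mulVec_mulVec, hC, Matrix.one_mulVec, Matrix.mulVec_zero] at this
  have hMz : (M.map f).mulVec (B.mulVec z) = 0 := by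
    rw [Matrix.mulVec_mulVec, hB, Matrix.zero_mulVec]
  have hli := hX (B.mulVec z) hBz0 h0 (by rw [aeval_quadraticFormOf, hMz]; simp)
  have := hli.ne_zero 1
  apply this
  simp only [Matrix.cons_val_one, Matrix.cons_val_fin_one]
  rw [gradientAt_quadraticFormOf hM, hMz, smul_zero]

theorem rank_pencilAt_of_ne_zero (P : MvPolynomial (Fin n) K) (M : Matrix (Fin n) (Fin n) K)
    {t₁ : L} (ht₁ : t₁ ≠ 0) (t₂ : L) (x : Fin n → L) :
    (pencilAt P M t₁ t₂ x).rank =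
      (hessianAt P x + (t₁⁻¹ * t₂) • M.map (algebraMap K L)).rank := by
  rw [← Matrix.rank_smul_of_mem_nonZeroDivisors (c := t₁) (hessianAt P x + _)
    (mem_nonZeroDivisors_of_ne_zero ht₁), smul_add, smul_smul, mul_inv_cancel_left₀ ht₁]
  rfl

theorem rank_pencilAt_zero (P : MvPolynomial (Fin n) K) (M : Matrix (Fin n) (Fin n) K)
    {t₂ : L} (ht₂ : t₂ ≠ 0) (x : Fin n → L) : (pencilAt P M 0 t₂ x).rank = M.rank := by
  rw [← rank_map_ringHom (algebraMap K L) M,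
    ← Matrix.rank_smul_of_mem_nonZeroDivisors (c := t₂) (M.map _)
      (mem_nonZeroDivisors_of_ne_zero ht₂)]
  simp [pencilAt]

end Quadric

/-! ### Dimension of the low-rank locus -/

section LowRankLocus

variable {K : Type*} [Field K] {n : ℕ}

theorem affineDim_zariskiClosure {L : Type*} [Field L] (S : Set (Fin n → L)) :
    affineDim (zariskiClosure S) = ringKrullDim (MvPolynomial (Fin n) L ⧸ vanishingIdeal L S) := by
  have h : vanishingIdeal L (zariskiClosure S) = vanishingIdeal L S :=
    (zeroLocus_vanishingIdeal_galoisConnection (k := L) (K := L)).u_l_u_eq_u S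
  rw [affineDim, h]

theorem affineDim_le {L : Type*} [Field L] (V : Set (Fin n → L)) : affineDim V ≤ n := by
  refine (ringKrullDim_quotient_le _).trans (le_of_eq ?_)
  rw [MvPolynomial.ringKrullDim_of_isNoetherianRing, ringKrullDim_eq_zero_of_field, zero_add,
    Nat.card_fin]

/-- The matrix `H(x) + t M` with indeterminate `x` and `t`. -/
def genericPencil (L : Type*) [Field L] [Algebra K L] (P : MvPolynomial (Fin n) K)
    (M : Matrix (Fin n) (Fin n) K) : Matrix (Fin n) (Fin n) (MvPolynomial (Option (Fin n)) L) :=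
  Matrix.of fun i j => aeval (fun a => (X (some a) : MvPolynomial (Option (Fin n)) L))
    (pderiv i (pderiv j P)) + X none * algebraMap K _ (M i j)

theorem genericPencil_map {L E : Type*} [Field L] [Algebra K L] [Field E] [Algebra K E]
    [Algebra L E] [IsScalarTower K L E] (P : MvPolynomial (Fin n) K)
    (M : Matrix (Fin n) (Fin n) K) (φ : MvPolynomial (Option (Fin n)) L →ₐ[L] E) :
    (genericPencil L P M).map φ =
      hessianAt P (fun i => φ (X (some i))) + φ (X none) • M.map (algebraMap K E) := by
  ext i j
  simp only [genericPencil, Matrix.map_apply, Matrix.of_apply, map_add, map_mul, hessianAt,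
    Matrix.add_apply, Matrix.smul_apply, smul_eq_mul]
  congr 1
  · exact comp_aeval_apply _ (φ.restrictScalars K) _
  · congr 1
    exact (φ.restrictScalars K).commutes _

/-- The locus is the projection of the set `W` of pairs `(x, t)`. A minimal prime of its ideal is
contracted from a prime `q` containing the ideal of `W`. The transcendence degree bound applies to
the residue field of `q`, into which the coordinate ring of the component embeds. -/
theorem ringKrullDim_vanishingIdeal_le {L : Type*} [Field L] [Algebra K L]
    {P : MvPolynomial (Fin n) K} (hP : P.IsHomogeneous 3) (hns : IsNonsingularForm P)
    (h2 : (2 : K) ≠ 0) (h3 : (3 : K) ≠ 0) (M : Matrix (Fin n) (Fin n) K) (r : ℕ) :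
    ringKrullDim (MvPolynomial (Fin n) L ⧸ vanishingIdeal L
      {x : Fin n → L | ∃ t : L, (hessianAt P x + t • M.map (algebraMap K L)).rank ≤ r}) ≤
      ((r + 1 : ℕ) : WithBot ℕ∞) := by
  classical
  let f : MvPolynomial (Fin n) L →ₐ[L] MvPolynomial (Option (Fin n)) L := rename some
  let W : Set (Option (Fin n) → L) :=
    {w | (hessianAt P (w ∘ some) + w none • M.map (algebraMap K L)).rank ≤ r}
  have hcomap : vanishingIdeal L
      {x : Fin n → L | ∃ t : L, (hessianAt P x + t • M.map (algebraMap K L)).rank ≤ r} =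
      (vanishingIdeal L W).comap (f : MvPolynomial (Fin n) L →+* _) := by
    ext p
    simp only [mem_vanishingIdeal_iff, Ideal.mem_comap]
    constructor
    · intro h w hw
      change aeval w (rename some p) = 0
      rw [aeval_rename]
      exact h _ ⟨w none, hw⟩
    · rintro h x ⟨t, ht⟩
      have h1 := h (fun o => o.elim t x) ht
      change aeval _ (rename some p) = 0 at h1
      rw [aeval_rename] at h1
      exact h1
  refine ringKrullDim_quotient_le_of_minimalPrimes _ _ fun p hp => ?_
  rw [hcomap] at hp
  obtain ⟨q, hq, hWq, rfl⟩ := Ideal.exists_comap_eq_of_mem_minimalPrimes _ p hp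
  let E := FractionRing (MvPolynomial (Option (Fin n)) L ⧸ q)
  let φ : MvPolynomial (Option (Fin n)) L →ₐ[L] E :=
    (IsScalarTower.toAlgHom L (MvPolynomial (Option (Fin n)) L ⧸ q) E).comp (Ideal.Quotient.mkₐ L q)
  have hφ : ∀ a, φ a = 0 ↔ a ∈ q := by
    intro a
    change algebraMap (MvPolynomial (Option (Fin n)) L ⧸ q) E (Ideal.Quotient.mk q a) = 0 ↔ _
    rw [IsFractionRing.to_map_eq_zero_iff, Ideal.Quotient.eq_zero_iff_mem]
  let x : Fin n → E := fun i => φ (X (some i))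
  let t : E := φ (X none)
  -- Minors of size greater than `r` vanish on `W`, hence lie in `q` and vanish at its generic
  -- point.
  have hrank : (hessianAt P x + t • M.map (algebraMap K E)).rank ≤ r := by
    by_contra hlt
    rw [not_le] at hlt
    obtain ⟨d, hd, a, b, hab⟩ : ∃ d, r < d ∧ ∃ a b : Fin d → Fin n,
        ((hessianAt P x + t • M.map (algebraMap K E)).submatrix a b).det ≠ 0 :=
      ⟨_, hlt, exists_det_submatrix_ne_zero _⟩
    have hdet : ∀ {E' : Type _} [Field E'] [Algebra L E']
        (ψ : MvPolynomial (Option (Fin n)) L →ₐ[L] E'),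
        ψ ((genericPencil L P M).submatrix a b).det =
          (((genericPencil L P M).map ψ).submatrix a b).det := by
      intro E' _ _ ψ
      rw [AlgHom.map_det, AlgHom.mapMatrix_apply, Matrix.submatrix_map]
    rw [← genericPencil_map P M φ, ← hdet φ] at hab
    refine hab ((hφ _).2 (hWq ?_))
    rw [mem_vanishingIdeal_iff]
    intro w hw
    by_contra hne
    rw [hdet (aeval w), genericPencil_map] at hne
    simp only [aeval_X] at hne
    exact absurd (le_rank_of_det_submatrix_ne_zero _ a b hne) (not_le.2 (lt_of_le_of_lt hw hd))
  have hgen : IntermediateField.adjoin L (insert t (Set.range x)) = ⊤ := by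
    have hpoly : ∀ a, φ a ∈ IntermediateField.adjoin L (insert t (Set.range x)) := by
      intro a
      induction a using MvPolynomial.induction_on with
      | C c =>
        have : φ (C c) = algebraMap L E c := φ.commutes c
        rw [this]
        exact IntermediateField.algebraMap_mem _ c
      | add a b ha hb => rw [map_add]; exact add_mem ha hb
      | mul_X a i ha =>
        rw [map_mul]
        refine mul_mem ha (IntermediateField.subset_adjoin _ _ ?_)
        cases i with
        | none => exact Set.mem_insert _ _
        | some i => exact Set.mem_insert_of_mem _ ⟨i, rfl⟩
    refine top_unique fun z _ => ?_
    obtain ⟨a, b, -, rfl⟩ :=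
      IsFractionRing.div_surjective (A := MvPolynomial (Option (Fin n)) L ⧸ q) z
    obtain ⟨a, rfl⟩ := Ideal.Quotient.mk_surjective a
    obtain ⟨b, rfl⟩ := Ideal.Quotient.mk_surjective b
    exact div_mem (hpoly a) (hpoly b)
  have htr := trdeg_le_rank_add_card hP hns h2 h3 M x t hgen {t}
    (Algebra.subset_adjoin (by simp))
  obtain ⟨s, v, hv, hdim⟩ := exists_algebraicIndependent_ringKrullDim_le L
    (MvPolynomial (Fin n) L ⧸ q.comap (f : MvPolynomial (Fin n) L →+* _))
  let g : (MvPolynomial (Fin n) L ⧸ q.comap (f : MvPolynomial (Fin n) L →+* _)) →ₐ[L] E :=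
    Ideal.Quotient.liftₐ _ (φ.comp f) fun a ha => (hφ _).2 ha
  have hg : Function.Injective g := by
    refine RingHom.lift_injective_of_ker_le_ideal _ _ fun a ha => ?_
    exact (hφ _).1 ha
  have hs := (hv.map' hg).lift_cardinalMk_le_trdeg
  rw [Cardinal.mk_fin, Cardinal.lift_natCast, Cardinal.lift_id'] at hs
  have hs' : s ≤ r + 1 := by
    have h4 := hs.trans htr
    rw [Nat.cast_le, Finset.card_singleton] at h4
    omega
  exact hdim.trans (by exact_mod_cast hs')

theorem affineDim_lowRankLocus_le {L : Type*} [Field L] [Algebra K L]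
    {P : MvPolynomial (Fin n) K} (hP : P.IsHomogeneous 3) (hns : IsNonsingularForm P)
    (h2 : (2 : K) ≠ 0) (h3 : (3 : K) ≠ 0) {M : Matrix (Fin n) (Fin n) K} (hM : M.IsSymm)
    (hX : IsNonsingularCompleteIntersection P (quadraticFormOf M)) {r : ℕ} (hr : r + 1 ≤ n) :
    affineDim (zariskiClosure (lowRankLocus L P M r)) ≤ ((r + 1 : ℕ) : WithBot ℕ∞) := by
  rcases hr.eq_or_lt with rfl | hlt
  -- If `r = n - 1`, then `M` itself may have rank at most `r`, making the locus the whole space;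
  -- the bound is then `n`.
  · exact affineDim_le _
  have hS : lowRankLocus L P M r =
      {x : Fin n → L | ∃ t : L, (hessianAt P x + t • M.map (algebraMap K L)).rank ≤ r} := by
    ext x
    constructor
    · rintro ⟨t₁, t₂, h0, hx⟩
      by_cases ht₁ : t₁ = 0
      · subst ht₁
        have ht₂ : t₂ ≠ 0 := fun h => h0 (by rw [h])
        rw [rank_pencilAt_zero P M ht₂] at hx
        have := le_rank_add_one hP hM hX
        omega
      · exact ⟨t₁⁻¹ * t₂, by rwa [rank_pencilAt_of_ne_zero P M ht₁] at hx⟩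
    · rintro ⟨t, ht⟩
      refine ⟨1, t, by simp, ?_⟩
      rwa [rank_pencilAt_of_ne_zero P M one_ne_zero, inv_one, one_mul]
  rw [affineDim_zariskiClosure, hS]
  exact ringKrullDim_vanishingIdeal_le hP hns h2 h3 M r

end LowRankLocus

/-! ### Common zeros over `F(T)` by counting coefficients -/

section TsenLang

variable {F : Type*} [Field F] {σ : Type*}

/-- Substitute polynomials of degree at most `s` in `T` with indeterminate coefficients for the
variables of a polynomial over `F[T]`. -/
def genericSubst (s : ℕ) :
    MvPolynomial σ (Polynomial F) →+* Polynomial (MvPolynomial (σ × Fin (s + 1)) F) :=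
  eval₂Hom (Polynomial.mapRingHom C)
    fun i => ∑ e : Fin (s + 1), Polynomial.C (X (i, e)) * Polynomial.X ^ (e : ℕ)

/-- A polynomial in `T` with prescribed coefficients. -/
def polynomialPoint {s : ℕ} (c : σ × Fin (s + 1) → F) (i : σ) : Polynomial F :=
  ∑ e : Fin (s + 1), Polynomial.C (c (i, e)) * Polynomial.X ^ (e : ℕ)

/-- Thus the coefficients in `T` of the generic substitution are the equations over `F` that `c`
must satisfy. -/
theorem map_eval_genericSubst {s : ℕ} (c : σ × Fin (s + 1) → F)
    (G : MvPolynomial σ (Polynomial F)) :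
    (genericSubst s G).map (eval c) = eval (polynomialPoint c) G := by
  rw [← Polynomial.coe_mapRingHom, genericSubst, coe_eval₂Hom, eval₂_comp_left, ← coe_eval₂Hom]
  refine DFunLike.congr_fun (?_ : _ = eval (polynomialPoint c)) G
  rw [eval]
  congr 1
  · ext a
    · simp
    · simp
  · ext1 i
    simp [polynomialPoint, Polynomial.map_sum]

theorem polynomialPoint_coeff {s : ℕ} (c : σ × Fin (s + 1) → F) (i : σ) (e : Fin (s + 1)) :
    (polynomialPoint c i).coeff e = c (i, e) := by
  simp only [polynomialPoint, Polynomial.finsetSum_coeff, Polynomial.coeff_C_mul_X_pow]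
  simp [Fin.val_inj]

/-- Every coefficient is homogeneous of degree `d`. -/
def CoeffsHomogeneous {τ : Type*} (p : Polynomial (MvPolynomial τ F)) (d : ℕ) : Prop :=
  ∀ j, (p.coeff j).IsHomogeneous d

namespace CoeffsHomogeneous

variable {τ : Type*} {p q : Polynomial (MvPolynomial τ F)} {d e : ℕ}

theorem sum {ι : Type*} (s : Finset ι) (f : ι → Polynomial (MvPolynomial τ F))
    (h : ∀ i ∈ s, CoeffsHomogeneous (f i) d) : CoeffsHomogeneous (∑ i ∈ s, f i) d := fun j => by
  rw [Polynomial.finsetSum_coeff]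
  exact IsHomogeneous.sum _ _ _ fun i hi => h i hi j

theorem mul (hp : CoeffsHomogeneous p d) (hq : CoeffsHomogeneous q e) :
    CoeffsHomogeneous (p * q) (d + e) := fun j => by
  rw [Polynomial.coeff_mul]
  exact IsHomogeneous.sum _ _ _ fun i _ => (hp _).mul (hq _)

theorem map_C (a : Polynomial F) :
    CoeffsHomogeneous (a.map (C : F →+* MvPolynomial τ F)) 0 := fun j => by
  rw [Polynomial.coeff_map]
  exact isHomogeneous_C _ _

theorem prod_pow (s : Finset σ) (f : σ → Polynomial (MvPolynomial τ F)) (m : σ → ℕ)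
    (h : ∀ i, CoeffsHomogeneous (f i) 1) :
    CoeffsHomogeneous (∏ i ∈ s, f i ^ m i) (∑ i ∈ s, m i) := by
  classical
  have h1 : CoeffsHomogeneous (1 : Polynomial (MvPolynomial τ F)) 0 := by
    simpa using map_C (τ := τ) (1 : Polynomial F)
  have hpow : ∀ i k, CoeffsHomogeneous (f i ^ k) k := by
    intro i k
    induction k with
    | zero => simpa using h1
    | succ k ih => rw [pow_succ]; exact ih.mul (h i)
  induction s using Finset.induction_on with
  | empty => simpa using h1
  | insert i s hi ih =>
    rw [Finset.prod_insert hi, Finset.sum_insert hi]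
    exact (hpow i _).mul ih

end CoeffsHomogeneous

theorem genericSubst_coeffsHomogeneous {G : MvPolynomial σ (Polynomial F)} {d : ℕ}
    (hG : G.IsHomogeneous d) (s : ℕ) : CoeffsHomogeneous (genericSubst s G) d := by
  rw [genericSubst, coe_eval₂Hom, eval₂_eq]
  refine CoeffsHomogeneous.sum _ _ fun m hm => ?_
  have hd : m.degree = d := by
    have := hG (mem_support_iff.1 hm)
    rw [Finsupp.degree_eq_weight_one]
    exact this
  have h1 : CoeffsHomogeneous (Polynomial.mapRingHom (C : F →+* MvPolynomial (σ × Fin (s + 1)) F)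
      (coeff m G) * ∏ i ∈ m.support,
        (∑ e : Fin (s + 1), Polynomial.C (X (i, e)) * Polynomial.X ^ (e : ℕ)) ^ m i)
      (0 + ∑ i ∈ m.support, m i) := by
    refine (CoeffsHomogeneous.map_C _).mul (CoeffsHomogeneous.prod_pow _ _ _ fun i => ?_)
    refine CoeffsHomogeneous.sum _ _ fun e _ j => ?_
    rw [Polynomial.coeff_C_mul_X_pow]
    split_ifs
    · exact isHomogeneous_X _ _
    · exact isHomogeneous_zero _ _ _
  rwa [zero_add, ← Finsupp.degree_apply, hd] at h1

/-- `D` bounds the degrees of the coefficients of `G`. It does not depend on `s`, which is chosen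
afterwards. -/
theorem exists_natDegree_genericSubst_le {G : MvPolynomial σ (Polynomial F)} {d : ℕ}
    (hG : G.IsHomogeneous d) : ∃ D, ∀ s, (genericSubst s G).natDegree ≤ d * s + D := by
  refine ⟨G.support.sup fun m => (coeff m G).natDegree, fun s => ?_⟩
  rw [genericSubst, coe_eval₂Hom, eval₂_eq]
  refine Polynomial.natDegree_sum_le_of_forall_le _ _ fun m hm => ?_
  have hd : m.degree = d := by
    have := hG (mem_support_iff.1 hm)
    rw [Finsupp.degree_eq_weight_one]
    exact this
  refine Polynomial.natDegree_mul_le.trans ?_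
  rw [add_comm]
  refine add_le_add ?_ ((Polynomial.natDegree_map_le).trans
    (Finset.le_sup (f := fun m => (coeff m G).natDegree) hm))
  refine (Polynomial.natDegree_prod_le _ _).trans ?_
  rw [← hd, Finsupp.degree_apply, Finset.sum_mul]
  refine Finset.sum_le_sum fun i _ => ?_
  refine Polynomial.natDegree_pow_le.trans (Nat.mul_le_mul_left _ ?_)
  refine Polynomial.natDegree_sum_le_of_forall_le _ _ fun e _ => ?_
  exact (Polynomial.natDegree_C_mul_X_pow_le _ _).trans (Nat.lt_succ_iff.1 e.2)

theorem eval_polynomialPoint_eq_zero {s : ℕ} (c : σ × Fin (s + 1) → F)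
    (G : MvPolynomial σ (Polynomial F)) {N : ℕ} (hN : (genericSubst s G).natDegree ≤ N)
    (h : ∀ j : Fin (N + 1), eval c ((genericSubst s G).coeff j) = 0) :
    eval (polynomialPoint c) G = 0 := by
  rw [← map_eval_genericSubst]
  ext j
  rw [Polynomial.coeff_map, Polynomial.coeff_zero]
  by_cases hj : j < N + 1
  · exact h ⟨j, hj⟩
  · rw [Polynomial.coeff_eq_zero_of_natDegree_lt (by omega), map_zero]

/-- A cubic and a quadratic form in at least `14` variables over `F[T]`, with `F` finite, have a
nontrivial common zero. -/
theorem exists_common_zero_polynomial [Finite F] {n : ℕ} (hn : 14 ≤ n)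
    {G₁ G₂ : MvPolynomial (Fin n) (Polynomial F)} (hG₁ : G₁.IsHomogeneous 3)
    (hG₂ : G₂.IsHomogeneous 2) :
    ∃ x : Fin n → Polynomial F, x ≠ 0 ∧ eval x G₁ = 0 ∧ eval x G₂ = 0 := by
  classical
  have := Fintype.ofFinite F
  obtain ⟨D₁, hD₁⟩ := exists_natDegree_genericSubst_le hG₁
  obtain ⟨D₂, hD₂⟩ := exists_natDegree_genericSubst_le hG₂
  -- The total degree is at most `3(3s + D₁ + 1) + 2(2s + D₂ + 1) = 13s + 3D₁ + 2D₂ + 5`, against at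
  -- least `14(s + 1)` unknowns; this `s` makes the latter larger.
  let s := 3 * D₁ + 2 * D₂
  let f : Fin (3 * s + D₁ + 1) ⊕ Fin (2 * s + D₂ + 1) → MvPolynomial (Fin n × Fin (s + 1)) F :=
    Sum.elim (fun j => (genericSubst s G₁).coeff j) (fun j => (genericSubst s G₂).coeff j)
  have h₁ := genericSubst_coeffsHomogeneous hG₁ s
  have h₂ := genericSubst_coeffsHomogeneous hG₂ s
  have hdeg : ∑ i, (f i).totalDegree < Fintype.card (Fin n × Fin (s + 1)) := by
    rw [Fintype.sum_sum_type, Fintype.card_prod, Fintype.card_fin, Fintype.card_fin]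
    have e₁ : ∑ i, (f (Sum.inl i)).totalDegree ≤ ∑ _i : Fin (3 * s + D₁ + 1), 3 :=
      Finset.sum_le_sum fun j _ => (h₁ j).totalDegree_le
    have e₂ : ∑ i, (f (Sum.inr i)).totalDegree ≤ ∑ _i : Fin (2 * s + D₂ + 1), 2 :=
      Finset.sum_le_sum fun j _ => (h₂ j).totalDegree_le
    rw [Finset.sum_const, Finset.card_univ, Fintype.card_fin, smul_eq_mul] at e₁ e₂
    have e₃ : 14 * (s + 1) ≤ n * (s + 1) := Nat.mul_le_mul_right _ hn
    omega
  obtain ⟨p, hp⟩ := CharP.exists F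
  have hprime : p.Prime := (CharP.char_is_prime_or_zero F p).resolve_right
    (CharP.char_ne_zero_of_finite F p)
  -- Chevalley–Warning: the number of solutions is divisible by `p`, so the zero solution is not the
  -- only one.
  have hdvd := char_dvd_card_solutions_of_fintype_sum_lt p hdeg
  have hz : ∀ {q : MvPolynomial (Fin n × Fin (s + 1)) F} {d : ℕ}, q.IsHomogeneous d → d ≠ 0 →
      eval 0 q = 0 := fun hq hd => by
    have := aeval_smul_of_isHomogeneous hq (0 : F) 0
    rw [zero_pow hd, zero_mul, smul_zero] at this
    exact this
  have h0 : ∀ i, eval (0 : Fin n × Fin (s + 1) → F) (f i) = 0 := by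
    rintro (j | j)
    · exact hz (h₁ j) (by norm_num)
    · exact hz (h₂ j) (by norm_num)
  have hcard : 1 < Fintype.card {c : Fin n × Fin (s + 1) → F // ∀ i, eval c (f i) = 0} :=
    hprime.one_lt.trans_le (Nat.le_of_dvd (Fintype.card_pos_iff.2 ⟨⟨0, h0⟩⟩) hdvd)
  obtain ⟨⟨c, hc⟩, hne⟩ := Fintype.exists_ne_of_one_lt_card hcard ⟨0, h0⟩
  refine ⟨polynomialPoint c, ?_, ?_, ?_⟩
  · intro hx
    apply hne
    refine Subtype.ext (funext fun ie => ?_)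
    have := polynomialPoint_coeff c ie.1 ie.2
    rw [hx] at this
    exact this.symm
  · exact eval_polynomialPoint_eq_zero c G₁ (hD₁ s) fun j => hc (Sum.inl j)
  · exact eval_polynomialPoint_eq_zero c G₂ (hD₂ s) fun j => hc (Sum.inr j)

theorem exists_common_zero_ratFunc [Finite F] {n : ℕ} (hn : 14 ≤ n)
    {F₁ F₂ : MvPolynomial (Fin n) (RatFunc F)} (hF₁ : F₁.IsHomogeneous 3)
    (hF₂ : F₂.IsHomogeneous 2) :
    ∃ x : Fin n → RatFunc F, x ≠ 0 ∧ aeval x F₁ = 0 ∧ aeval x F₂ = 0 := by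
  let _ := algebraMvPolynomial (σ := Fin n) (R := Polynomial F) (S := RatFunc F)
  have hinj : Function.Injective (algebraMap (Polynomial F) (RatFunc F)) :=
    IsFractionRing.injective _ _
  have hclear : ∀ {d : ℕ} {P : MvPolynomial (Fin n) (RatFunc F)}, P.IsHomogeneous d →
      ∃ G : MvPolynomial (Fin n) (Polynomial F), G.IsHomogeneous d ∧
        ∀ x : Fin n → Polynomial F, eval x G = 0 →
          aeval (fun i => algebraMap (Polynomial F) (RatFunc F) (x i)) P = 0 := by
    intro d P hP
    obtain ⟨⟨G, b⟩, hG⟩ := IsLocalization.surj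
      ((nonZeroDivisors (Polynomial F)).map (C (σ := Fin n))) P
    obtain ⟨-, ⟨b, hb, rfl⟩⟩ := b
    rw [algebraMap_def, map_C] at hG
    have hb0 : algebraMap (Polynomial F) (RatFunc F) b ≠ 0 :=
      IsFractionRing.to_map_ne_zero_of_mem_nonZeroDivisors hb
    refine ⟨G, ?_, fun x hx => ?_⟩
    · refine IsHomogeneous.of_map (f := algebraMap (Polynomial F) (RatFunc F)) hinj ?_
      rw [← hG]
      simpa using hP.mul (isHomogeneous_C (Fin n) (algebraMap (Polynomial F) (RatFunc F) b))
    · have h1 := congrArg (aeval fun i => algebraMap (Polynomial F) (RatFunc F) (x i)) hG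
      rw [map_mul, aeval_C] at h1
      have h2 : aeval (fun i => algebraMap (Polynomial F) (RatFunc F) (x i))
          (map (algebraMap (Polynomial F) (RatFunc F)) G) = 0 := by
        rw [aeval_map_algebraMap]
        refine (aeval_algebraMap_apply (RatFunc F) x G).trans ?_
        change algebraMap _ _ (eval x G) = 0
        rw [hx, map_zero]
      rw [h2] at h1
      exact (mul_eq_zero.1 h1).resolve_right hb0
  obtain ⟨G₁, hG₁, h₁⟩ := hclear hF₁
  obtain ⟨G₂, hG₂, h₂⟩ := hclear hF₂
  obtain ⟨x, hx, hx₁, hx₂⟩ := exists_common_zero_polynomial hn hG₁ hG₂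
  refine ⟨_, fun h => hx (funext fun i => hinj ?_), h₁ x hx₁, h₂ x hx₂⟩
  rw [congrFun h i]
  simp

end TsenLang

/-! ### Implicit functions and independent coordinates -/

section ImplicitFunction

variable {K L : Type*} [Field K] [NontriviallyNormedField L] [Algebra K L] {n : ℕ}

/-- The derivative of a polynomial function, as a continuous linear form. -/
def gradientForm (P : MvPolynomial (Fin n) K) (a : Fin n → L) : (Fin n → L) →L[L] L :=
  ∑ i, gradientAt P a i • ContinuousLinearMap.proj i

theorem gradientForm_apply (P : MvPolynomial (Fin n) K) (a v : Fin n → L) :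
    gradientForm P a v = ∑ i, gradientAt P a i * v i := by
  simp [gradientForm]

theorem hasStrictFDerivAt_aeval (P : MvPolynomial (Fin n) K) (a : Fin n → L) :
    HasStrictFDerivAt (fun x : Fin n → L => aeval x P) (gradientForm P a) a := by
  induction P using MvPolynomial.induction_on with
  | C c =>
    have h : gradientForm (C c) a = 0 := by
      ext v
      simp [gradientForm_apply, gradientAt]
    simp only [aeval_C, h]
    exact hasStrictFDerivAt_const _ _
  | add p q hp hq =>
    have h : gradientForm (p + q) a = gradientForm p a + gradientForm q a := by
      ext1 v
      simp [gradientForm_apply, gradientAt, add_mul, Finset.sum_add_distrib]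
    simp only [map_add, h]
    exact hp.add hq
  | mul_X p j hp =>
    have h : gradientForm (p * X j) a =
        aeval a p • ContinuousLinearMap.proj j + a j • gradientForm p a := by
      ext1 v
      simp only [gradientForm_apply, gradientAt, pderiv_mul, map_add, map_mul, aeval_X, pderiv_X,
        add_mul, Finset.sum_add_distrib, _root_.add_apply,
        _root_.smul_apply, ContinuousLinearMap.proj_apply, smul_eq_mul,
        Finset.mul_sum]
      rw [add_comm]
      congr 1
      · rw [Finset.sum_eq_single j]
        · simp
        · intro i _ hij
          simp [hij.symm]
        · simp
      · exact Finset.sum_congr rfl fun i _ => by ring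
    simp only [map_mul, aeval_X, h]
    exact hp.mul (ContinuousLinearMap.proj (R := L) (φ := fun _ : Fin n => L) j).hasStrictFDerivAt

/-- Near a point where the minor of the Jacobian matrix of `P, Q` in the coordinates `i, j` does not
vanish, the other coordinates can be prescribed arbitrarily on `P = Q = 0`. -/
theorem exists_zero_with_coordinates [CompleteSpace L] {P Q : MvPolynomial (Fin n) K}
    {a : Fin n → L} (hPa : aeval a P = 0) (hQa : aeval a Q = 0) {i j : Fin n}
    (hij : gradientAt P a i * gradientAt Q a j - gradientAt P a j * gradientAt Q a i ≠ 0) :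
    ∃ U : Fin n → Set L, (∀ l, IsOpen (U l) ∧ (U l).Nonempty) ∧
      ∀ b : Fin n → L, (∀ l, l ≠ i → l ≠ j → b l ∈ U l) →
        ∃ x : Fin n → L, aeval x P = 0 ∧ aeval x Q = 0 ∧ ∀ l, l ≠ i → l ≠ j → x l = b l := by
  have hne : i ≠ j := by
    rintro rfl
    simp at hij
  -- Coordinates `i` and `j` are replaced by the values of `P` and `Q`; the nonzero minor makes the
  -- derivative of `G` at `a` invertible.
  let G : (Fin n → L) → Fin n → L :=
    fun x l => if l = i then aeval x P else if l = j then aeval x Q else x l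
  let G' : (Fin n → L) →L[L] (Fin n → L) := ContinuousLinearMap.pi fun l =>
    if l = i then gradientForm P a else if l = j then gradientForm Q a
      else ContinuousLinearMap.proj l
  have hG : HasStrictFDerivAt G G' a := by
    refine hasStrictFDerivAt_pi.2 fun l => ?_
    by_cases hi : l = i
    · simp only [hi, if_true]
      exact hasStrictFDerivAt_aeval P a
    · by_cases hj : l = j
      · simp only [hj, if_true, if_false, hne.symm]
        exact hasStrictFDerivAt_aeval Q a
      · simp only [hi, hj, if_false]
        exact (ContinuousLinearMap.proj (R := L) (φ := fun _ : Fin n => L) l).hasStrictFDerivAt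
  have hinj : Function.Injective G'.toLinearMap := by
    rw [← LinearMap.ker_eq_bot, LinearMap.ker_eq_bot']
    intro v hv
    have hv : ∀ l, G' v l = 0 := fun l => congrFun hv l
    have hl : ∀ l, l ≠ i → l ≠ j → v l = 0 := by
      intro l hi hj
      have := hv l
      simpa [G', hi, hj] using this
    have hsum : ∀ g : Fin n → L, ∑ l, g l * v l = g i * v i + g j * v j := by
      intro g
      rw [← Finset.sum_pair (f := fun l => g l * v l) hne]
      symm
      refine Finset.sum_subset (Finset.subset_univ _) fun l _ h => ?_
      simp only [Finset.mem_insert, Finset.mem_singleton, not_or] at h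
      rw [hl l h.1 h.2, mul_zero]
    have h1 : gradientAt P a i * v i + gradientAt P a j * v j = 0 := by
      rw [← hsum, ← gradientForm_apply]
      simpa [G'] using hv i
    have h2 : gradientAt Q a i * v i + gradientAt Q a j * v j = 0 := by
      rw [← hsum, ← gradientForm_apply]
      simpa [G', hne.symm] using hv j
    have hi0 : v i = 0 := by
      refine (mul_eq_zero.1 (?_ : (gradientAt P a i * gradientAt Q a j -
        gradientAt P a j * gradientAt Q a i) * v i = 0)).resolve_left hij
      linear_combination gradientAt Q a j * h1 - gradientAt P a j * h2
    have hj0 : v j = 0 := by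
      refine (mul_eq_zero.1 (?_ : (gradientAt P a i * gradientAt Q a j -
        gradientAt P a j * gradientAt Q a i) * v j = 0)).resolve_left hij
      linear_combination gradientAt P a i * h2 - gradientAt Q a i * h1
    ext l
    by_cases h : l = i
    · rw [h, hi0]; rfl
    · by_cases h' : l = j
      · rw [h', hj0]; rfl
      · rw [hl l h h']; rfl
  have hsurj : G'.range = ⊤ := LinearMap.range_eq_top.2 (LinearMap.injective_iff_surjective.1 hinj)
  have hmap := hG.map_nhds_eq_of_surj hsurj
  have hrange : Set.range G ∈ nhds (G a) := by
    rw [← hmap, ← Set.image_univ]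
    exact Filter.image_mem_map Filter.univ_mem
  obtain ⟨ε, hε, hball⟩ := Metric.mem_nhds_iff.1 hrange
  refine ⟨fun l => Metric.ball (G a l) ε, fun l => ⟨Metric.isOpen_ball, _,
    Metric.mem_ball_self hε⟩, fun b hb => ?_⟩
  let c : Fin n → L := fun l => if l = i then 0 else if l = j then 0 else b l
  have hc : c ∈ Metric.ball (G a) ε := by
    rw [Metric.mem_ball, dist_pi_lt_iff hε]
    intro l
    by_cases hi : l = i
    · simp [c, G, hi, hPa, hε]
    · by_cases hj : l = j
      · simp [c, G, hj, hne.symm, hQa, hε]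
      · have := hb l hi hj
        simpa [c, hi, hj] using this
  obtain ⟨x, hx⟩ := hball hc
  refine ⟨x, ?_, ?_, fun l hi hj => ?_⟩
  · simpa [G, c] using congrFun hx i
  · simpa [G, c, hne.symm] using congrFun hx j
  · simpa [G, c, hi, hj] using congrFun hx l

/-- In a complete field that is nontrivially normed, algebraically independent elements over a
countable subfield can be found in any given nonempty open sets. -/
theorem exists_algebraicIndependent_mem [Countable K] [CompleteSpace L] {ι : Type*} [Finite ι]
    (U : ι → Set L) (hU : ∀ l, IsOpen (U l) ∧ (U l).Nonempty) :
    ∃ b : ι → L, (∀ l, b l ∈ U l) ∧ AlgebraicIndependent K b := by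
  classical
  have := Fintype.ofFinite ι
  have key : ∀ s : Finset ι, ∃ b : ι → L, (∀ l ∈ s, b l ∈ U l) ∧
      AlgebraicIndepOn K b (s : Set ι) := by
    intro s
    induction s using Finset.induction_on with
    | empty =>
      refine ⟨0, by simp, ?_⟩
      have : IsEmpty ((∅ : Finset ι) : Set ι) := by simp
      exact (algebraicIndependent_empty_type_iff).2 (algebraMap K L).injective
    | insert i s hi ih =>
      obtain ⟨b, hb, hind⟩ := ih
      let A := Algebra.adjoin K (b '' (s : Set ι))
      have hA : Countable A := by
        rw [← Cardinal.mk_le_aleph0_iff]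
        have h1 := Algebra.lift_cardinalMk_adjoin_le K (b '' (s : Set ι))
        have h2 : Cardinal.mk (b '' (s : Set ι)) ≤ Cardinal.aleph0 :=
          Cardinal.mk_le_aleph0_iff.2 ((s.finite_toSet.image b).countable.to_subtype)
        have h3 : Cardinal.mk K ≤ Cardinal.aleph0 := Cardinal.mk_le_aleph0_iff.2 inferInstance
        rw [← Cardinal.lift_le_aleph0]
        exact h1.trans (max_le (max_le (Cardinal.lift_le_aleph0.2 h3)
          (Cardinal.lift_le_aleph0.2 h2)) le_rfl)
      -- Only countably many elements are algebraic over the countable algebra `A`, so the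
      -- transcendental ones are dense.
      have hdense := Set.Countable.dense_compl (E := L) L (Algebraic.countable A L)
      obtain ⟨a, haU, ha⟩ := hdense.inter_open_nonempty (U i) (hU i).1 (hU i).2
      have hupd : ∀ l ∈ s, Function.update b i a l = b l := fun l hl =>
        Function.update_of_ne (ne_of_mem_of_not_mem hl hi) _ _
      refine ⟨Function.update b i a, ?_, ?_⟩
      · intro l hl
        rcases Finset.mem_insert.1 hl with rfl | hl
        · rwa [Function.update_self]
        · rw [hupd l hl]
          exact hb l hl
      · rw [Finset.coe_insert]
        refine AlgebraicIndepOn.insert ?_ ?_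
        · have : (fun l : (s : Set ι) => Function.update b i a l) = fun l : (s : Set ι) => b l :=
            funext fun l => hupd l l.2
          rw [AlgebraicIndepOn, this]
          exact hind
        · have : Function.update b i a '' (s : Set ι) = b '' (s : Set ι) :=
            Set.image_congr fun l hl => hupd l hl
          rw [this, Function.update_self]
          exact ha
  obtain ⟨b, hb, hind⟩ := key Finset.univ
  refine ⟨b, fun l => hb l (Finset.mem_univ l), ?_⟩
  rw [Finset.coe_univ] at hind
  exact hind.comp (fun l => (⟨l, Set.mem_univ l⟩ : (Set.univ : Set ι)))
    fun _ _ h => congrArg Subtype.val h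

end ImplicitFunction

/-! ### Ranks at a point with independent coordinates -/

section GenericPoint

variable {K L : Type*} [Field K] [Field L] [Algebra K L] {n : ℕ}

theorem isHomogeneous_quadraticFormOf (M : Matrix (Fin n) (Fin n) K) :
    (quadraticFormOf M).IsHomogeneous 2 :=
  IsHomogeneous.sum _ _ _ fun i _ => IsHomogeneous.sum _ _ _ fun j _ =>
    ((isHomogeneous_C (Fin n) (M i j)).mul (isHomogeneous_X K i)).mul (isHomogeneous_X K j)

/-- The Jacobian criterion at points with coordinates in an arbitrary extension field. -/
theorem exists_jacobian_minor_ne_zero {P Q : MvPolynomial (Fin n) K} {d e : ℕ}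
    (hP : P.IsHomogeneous d) (hQ : Q.IsHomogeneous e)
    (hX : IsNonsingularCompleteIntersection P Q) {a : Fin n → L} (ha : a ≠ 0)
    (hPa : aeval a P = 0) (hQa : aeval a Q = 0) :
    ∃ i j, gradientAt P a i * gradientAt Q a j - gradientAt P a j * gradientAt Q a i ≠ 0 := by
  by_contra! h
  obtain ⟨z, hz, hS⟩ := exists_algebraicClosure_point_ne_zero
    ({P, Q} ∪ Set.range fun ij : Fin n × Fin n =>
      pderiv ij.1 P * pderiv ij.2 Q - pderiv ij.2 P * pderiv ij.1 Q)
    (by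
      rintro p ((rfl | rfl) | ⟨ij, rfl⟩)
      · exact ⟨_, hP⟩
      · exact ⟨_, hQ⟩
      · exact ⟨_, (hP.pderiv.mul hQ.pderiv).sub (hP.pderiv.mul hQ.pderiv)⟩) a ha
    (by
      rintro p ((rfl | rfl) | ⟨ij, rfl⟩)
      · exact hPa
      · exact hQa
      · simpa [gradientAt] using h ij.1 ij.2)
  have hPz := hS P (Or.inl (Or.inl rfl))
  have hQz := hS Q (Or.inl (Or.inr rfl))
  have hmin : ∀ i j, gradientAt P z i * gradientAt Q z j -
      gradientAt P z j * gradientAt Q z i = 0 := fun i j => by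
    simpa [gradientAt] using hS _ (Or.inr ⟨(i, j), rfl⟩)
  have hli := hX z hz hPz hQz
  have hQ0 : gradientAt Q z ≠ 0 := hli.ne_zero 1
  obtain ⟨j, hj⟩ := Function.ne_iff.1 hQ0
  rw [LinearIndependent.pair_iff] at hli
  -- If all minors vanish, these coefficients give a linear relation, nontrivial because `gradientAt
  -- Q z j ≠ 0`.
  refine hj (hli (gradientAt Q z j) (-gradientAt P z j) ?_).1
  ext i
  simp only [Pi.add_apply, Pi.smul_apply, smul_eq_mul, Pi.zero_apply]
  linear_combination hmin i j

theorem le_card_ne_ne_add_two (i j : Fin n) :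
    n ≤ Fintype.card {l : Fin n // l ≠ i ∧ l ≠ j} + 2 := by
  classical
  have h1 : (Finset.univ.filter fun l : Fin n => l ≠ i ∧ l ≠ j) = Finset.univ \ {i, j} := by
    ext l
    simp
  rw [Fintype.card_subtype, h1]
  have h2 := Finset.le_card_sdiff ({i, j} : Finset (Fin n)) Finset.univ
  rw [Finset.card_univ, Fintype.card_fin] at h2
  have h3 := Finset.card_le_two (a := i) (b := j)
  omega

theorem le_rank_add_card_add_two {P : MvPolynomial (Fin n) K} (hP : P.IsHomogeneous 3)
    (hns : IsNonsingularForm P) (h2 : (2 : K) ≠ 0) (h3 : (3 : K) ≠ 0)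
    (M : Matrix (Fin n) (Fin n) K) (x : Fin n → L) (t : L)
    (hgen : IntermediateField.adjoin K (insert t (Set.range x)) = ⊤)
    (s : Finset L) (hs : t ∈ Algebra.adjoin K (s : Set L)) {i j : Fin n}
    (hx : AlgebraicIndependent K fun l : {l : Fin n // l ≠ i ∧ l ≠ j} => x l) :
    n ≤ (hessianAt P x + t • M.map (algebraMap K L)).rank + s.card + 2 := by
  have h4 := trdeg_le_rank_add_card hP hns h2 h3 M x t hgen s hs
  have h5 := hx.lift_cardinalMk_le_trdeg
  rw [Cardinal.mk_fintype, Cardinal.lift_natCast, Cardinal.lift_id'] at h5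
  have h6 := Nat.cast_le.1 (h5.trans h4)
  have h7 := le_card_ne_ne_add_two i j
  omega

/-- If all but two coordinates of `x` are algebraically independent, then the matrices
`H(x) + t M` have almost full rank. -/
theorem le_rank_of_algebraicIndependent {P : MvPolynomial (Fin n) K} (hP : P.IsHomogeneous 3)
    (hns : IsNonsingularForm P) (h2 : (2 : K) ≠ 0) (h3 : (3 : K) ≠ 0)
    (M : Matrix (Fin n) (Fin n) K) (x : Fin n → L) {i j : Fin n}
    (hx : AlgebraicIndependent K fun l : {l : Fin n // l ≠ i ∧ l ≠ j} => x l) (t : L) :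
    n ≤ (hessianAt P x + t • M.map (algebraMap K L)).rank + 3 ∧
      (t = 0 → n ≤ (hessianAt P x + t • M.map (algebraMap K L)).rank + 2) := by
  let E := IntermediateField.adjoin K (insert t (Set.range x))
  let t' : E := ⟨t, IntermediateField.subset_adjoin _ _ (Set.mem_insert _ _)⟩
  let x' : Fin n → E := fun l =>
    ⟨x l, IntermediateField.subset_adjoin _ _ (Set.mem_insert_of_mem _ ⟨l, rfl⟩)⟩
  have hgen : IntermediateField.adjoin K (insert t' (Set.range x')) = ⊤ := by
    apply IntermediateField.lift_injective E
    rw [IntermediateField.lift_adjoin, IntermediateField.lift_top]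
    have : (Subtype.val '' insert t' (Set.range x') : Set L) = insert t (Set.range x) := by
      rw [Set.image_insert_eq, ← Set.range_comp]
      rfl
    rw [this]
  have hx' : AlgebraicIndependent K fun l : {l : Fin n // l ≠ i ∧ l ≠ j} => x' l :=
    AlgebraicIndependent.of_comp E.val hx
  have hrank : (hessianAt P x + t • M.map (algebraMap K L)).rank =
      (hessianAt P x' + t' • M.map (algebraMap K E)).rank := by
    rw [← rank_map_ringHom (algebraMap E L)]
    congr 1
    ext a b
    simp only [Matrix.add_apply, Matrix.smul_apply, Matrix.map_apply, hessianAt, Matrix.of_apply,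
      smul_eq_mul, map_add, map_mul]
    congr 1
    exact (comp_aeval_apply x' E.val _).symm
  rw [hrank]
  refine ⟨?_, fun ht => ?_⟩
  · have := le_rank_add_card_add_two hP hns h2 h3 M x' t' hgen {t'}
      (Algebra.subset_adjoin (by simp)) hx'
    rw [Finset.card_singleton] at this
    omega
  -- For `t = 0` no generator is needed for `t`, which gains one in the rank.
  · have ht' : t' = 0 := Subtype.ext ht
    exact le_rank_add_card_add_two hP hns h2 h3 M x' t' hgen ∅
      (by rw [ht']; exact zero_mem _) hx'

end GenericPoint

/-! ### Generic points over a complete field -/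

section Completion

variable {K L : Type*} [Field K] [Countable K] [NontriviallyNormedField L] [CompleteSpace L]
  [Algebra K L] {n : ℕ}

/-- A nonsingular complete intersection with a point over a complete field has a point, over the
same field, with all but two coordinates algebraically independent over `K`. -/
theorem exists_generic_point {P Q : MvPolynomial (Fin n) K} {d e : ℕ}
    (hP : P.IsHomogeneous d) (hQ : Q.IsHomogeneous e)
    (hX : IsNonsingularCompleteIntersection P Q) {a : Fin n → L} (ha : a ≠ 0)
    (hPa : aeval a P = 0) (hQa : aeval a Q = 0) :
    ∃ (x : Fin n → L) (i j : Fin n), aeval x P = 0 ∧ aeval x Q = 0 ∧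
      AlgebraicIndependent K fun l : {l : Fin n // l ≠ i ∧ l ≠ j} => x l := by
  obtain ⟨i, j, hij⟩ := exists_jacobian_minor_ne_zero hP hQ hX ha hPa hQa
  obtain ⟨U, hU, hUx⟩ := exists_zero_with_coordinates hPa hQa hij
  obtain ⟨b, hbU, hb⟩ := exists_algebraicIndependent_mem (K := K)
    (fun l : {l : Fin n // l ≠ i ∧ l ≠ j} => U l) fun l => hU l
  classical
  obtain ⟨x, hxP, hxQ, hx⟩ := hUx (fun l => if h : l ≠ i ∧ l ≠ j then b ⟨l, h⟩ else 0)
    (fun l hi hj => by rw [dif_pos ⟨hi, hj⟩]; exact hbU ⟨l, hi, hj⟩)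
  refine ⟨x, i, j, hxP, hxQ, ?_⟩
  have : (fun l : {l : Fin n // l ≠ i ∧ l ≠ j} => x l) = b := funext fun l => by
    rw [hx l l.2.1 l.2.2, dif_pos l.2]
  rwa [this]

end Completion

/-! ### The completion at infinity -/

section FunctionField

variable {F : Type*} [Field F]

theorem countable_ratFunc [Finite F] : Countable (RatFunc F) := by
  rw [← Cardinal.mk_le_aleph0_iff]
  have h1 := IsLocalization.cardinalMk_le (L := RatFunc F) (nonZeroDivisors (Polynomial F))
  refine h1.trans (Polynomial.cardinalMk_le_max.trans (max_le ?_ le_rfl))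
  exact Cardinal.mk_le_aleph0

theorem exists_generic_point_completionAtInfty [Finite F] [DecidableEq (RatFunc F)] {n : ℕ}
    {P Q : MvPolynomial (Fin n) (RatFunc F)} {d e : ℕ}
    (hP : P.IsHomogeneous d) (hQ : Q.IsHomogeneous e)
    (hX : IsNonsingularCompleteIntersection P Q) {a : Fin n → RatFunc.CompletionAtInfty F}
    (ha : a ≠ 0) (hPa : aeval a P = 0) (hQa : aeval a Q = 0) :
    ∃ (x : Fin n → RatFunc.CompletionAtInfty F) (i j : Fin n), aeval x P = 0 ∧ aeval x Q = 0 ∧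
      AlgebraicIndependent (RatFunc F) fun l : {l : Fin n // l ≠ i ∧ l ≠ j} => x l := by
  have : Countable (RatFunc F) := countable_ratFunc
  let v : Valuation (RatFunc.CompletionAtInfty F) (WithZero (Multiplicative ℤ)) := Valued.v
  -- The valuation is nontrivial, as `X` has value `exp 1`, and its value group is Archimedean. So
  -- it has rank one and comes from a norm.
  have : v.IsNontrivial := by
    let _ := RatFunc.inftyValued F
    have h : v ((RatFunc.X : RatFunc F) : UniformSpace.Completion (RatFunc F)) =
        WithZero.exp 1 := by
      refine (Valued.valuedCompletion_apply (RatFunc.X : RatFunc F)).trans ?_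
      exact RatFunc.inftyValuation.X F
    exact ⟨_, h.trans_ne (by simp), h.trans_ne (by simp)⟩
  have : MulArchimedean (MonoidWithZeroHom.ValueGroup₀ (.ofClass v)) :=
    MulArchimedean.comap MonoidWithZeroHom.ValueGroup₀.embedding.toMonoidHom
      MonoidWithZeroHom.ValueGroup₀.embedding_strictMono
  let _ : v.RankOne := (Valuation.nonempty_rankOne_iff_mulArchimedean.2 this).some
  let _ : NontriviallyNormedField (RatFunc.CompletionAtInfty F) :=
    Valued.toNontriviallyNormedField (RatFunc.CompletionAtInfty F) (WithZero (Multiplicative ℤ))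
  have : CompleteSpace (RatFunc.CompletionAtInfty F) :=
    @UniformSpace.Completion.completeSpace _ (RatFunc.inftyValued F).toUniformSpace
  exact exists_generic_point hP hQ hX ha hPa hQa

end FunctionField

theorem ratFunc_natCast_ne_zero {F : Type*} [Field F] {m : ℕ} (hm : m ≠ 0)
    (h : m < ringChar F) : (m : RatFunc F) ≠ 0 := by
  have h1 : (m : F) ≠ 0 := fun h0 =>
    absurd (Nat.le_of_dvd (Nat.pos_of_ne_zero hm) ((ringChar.spec F m).1 h0)) (not_le.2 h)
  have h2 := (map_ne_zero (algebraMap F (RatFunc F))).2 h1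
  rwa [map_natCast] at h2

theorem exists_common_zero_completionAtInfty {F : Type*} [Field F] [Finite F]
    [DecidableEq (RatFunc F)] {n : ℕ} (hn : 14 ≤ n) {F₁ F₂ : MvPolynomial (Fin n) (RatFunc F)}
    (hF₁ : F₁.IsHomogeneous 3) (hF₂ : F₂.IsHomogeneous 2) :
    ∃ x : Fin n → RatFunc.CompletionAtInfty F, x ≠ 0 ∧ aeval x F₁ = 0 ∧ aeval x F₂ = 0 := by
  obtain ⟨x, hx, h₁, h₂⟩ := exists_common_zero_ratFunc hn hF₁ hF₂
  have hmap : ∀ P : MvPolynomial (Fin n) (RatFunc F), aeval x P = 0 →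
      aeval (fun i => algebraMap (RatFunc F) (RatFunc.CompletionAtInfty F) (x i)) P = 0 :=
    fun P hP => (aeval_algebraMap_apply (RatFunc.CompletionAtInfty F) x P).trans
      (by rw [hP, map_zero])
  refine ⟨_, fun h => hx (funext fun i => ?_), hmap F₁ h₁, hmap F₂ h₂⟩
  exact (map_eq_zero (algebraMap (RatFunc F) (RatFunc.CompletionAtInfty F))).1 (congrFun h i)

end CubicQuadric

end

/-! ### The main theorem -/

theorem mainTheorem9 {F : Type*} [Field F] [Finite F] [DecidableEq (RatFunc F)]
    (hchar : 3 < ringChar F) {n : ℕ}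
    (F₁ F₂ : MvPolynomial (Fin n) (RatFunc F)) (M : Matrix (Fin n) (Fin n) (RatFunc F))
    (hF₁ : F₁.IsHomogeneous 3) (hF₁ns : CubicQuadric.IsNonsingularForm F₁)
    (hM : M.IsSymm) (hF₂ : F₂ = CubicQuadric.quadraticFormOf M)
    (hX : CubicQuadric.IsNonsingularCompleteIntersection F₁ F₂) :
    (∀ (Ω : Type*) [Field Ω] [IsAlgClosed Ω] [Algebra (RatFunc F) Ω] (k : ℕ),
      1 ≤ k → k + 1 ≤ n →
        CubicQuadric.affineDim
          (CubicQuadric.zariskiClosure (CubicQuadric.lowRankLocus Ω F₁ M k)) ≤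
            ((k + 1 : ℕ) : WithBot ℕ∞)) ∧
    ((14 ≤ n ∨ ∃ x : Fin n → RatFunc.CompletionAtInfty F,
        x ≠ 0 ∧ MvPolynomial.aeval x F₁ = 0 ∧ MvPolynomial.aeval x F₂ = 0) →
      ∃ x₀ : Fin n → RatFunc.CompletionAtInfty F,
        MvPolynomial.aeval x₀ F₁ = 0 ∧ MvPolynomial.aeval x₀ F₂ = 0 ∧
        n ≤ (CubicQuadric.hessianAt F₁ x₀).rank + 2 ∧
        ∀ t₁ t₂ : RatFunc.CompletionAtInfty F, (t₁, t₂) ≠ (0, 0) →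
          n ≤ (CubicQuadric.pencilAt F₁ M t₁ t₂ x₀).rank + 3) := by
  have h2 : (2 : RatFunc F) ≠ 0 := by
    exact_mod_cast CubicQuadric.ratFunc_natCast_ne_zero two_ne_zero (by omega : 2 < ringChar F)
  have h3 : (3 : RatFunc F) ≠ 0 := by
    exact_mod_cast CubicQuadric.ratFunc_natCast_ne_zero three_ne_zero hchar
  subst hF₂
  refine ⟨fun Ω _ _ _ k _ hk =>
    CubicQuadric.affineDim_lowRankLocus_le hF₁ hF₁ns h2 h3 hM hX hk, fun h => ?_⟩
  have hQ := CubicQuadric.isHomogeneous_quadraticFormOf M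
  obtain ⟨a, ha, ha₁, ha₂⟩ := h.elim
    (fun hn => CubicQuadric.exists_common_zero_completionAtInfty hn hF₁ hQ) id
  obtain ⟨x₀, i, j, hx₁, hx₂, hx⟩ :=
    CubicQuadric.exists_generic_point_completionAtInfty hF₁ hQ hX ha ha₁ ha₂
  have hrank := CubicQuadric.le_rank_of_algebraicIndependent hF₁ hF₁ns h2 h3 M x₀ hx
  refine ⟨x₀, hx₁, hx₂, ?_, fun t₁ t₂ ht => ?_⟩
  · simpa using (hrank 0).2 rfl
  -- For `t₁ = 0` the matrix is a multiple of `M`, of rank at least `n - 1`; otherwise scaling gives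
  -- `t₁ = 1`.
  · by_cases ht₁ : t₁ = 0
    · subst ht₁
      have ht₂ : t₂ ≠ 0 := fun h0 => ht (by rw [h0])
      rw [CubicQuadric.rank_pencilAt_zero _ _ ht₂]
      have := CubicQuadric.le_rank_add_one hF₁ hM hX
      omega
    · rw [CubicQuadric.rank_pencilAt_of_ne_zero _ _ ht₁]
      exact (hrank _).1
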